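/- Let $X_j(t)$, $t\in[0,1]$, $j\in\mathbb N=\{1,2,\dots\}$, be zero-mean second-order random processes with continuous covariance functions $\mathcal K^{X_j}(t,s)$. For every $d\in\mathbb N$ let $Y_d(t)$, $t\in[0,1]^d$, be a zero-mean, jointly measurable, second-order random field with covariance function $\mathcal K^{Y_d}(t,s)=\sum_{j=1}^d\mathcal K^{X_j}(t_j,s_j)$, regarded as a random element of $L_2([0,1]^d)$ with norm $\|\cdot\|$ and scalar product $(\cdot,\cdot)$. For $\varepsilon\in(0,1)$ let $n^{Y_d}(\varepsilon)$ be the least $n\in\mathbb N$ with $e^{Y_d}(n)\le\varepsilon\, e^{Y_d}(0)$, where $e^{Y_d}(0)=(\mathbb E\|Y_d\|^2)^{1/2}$ and $$e^{Y_d}(n)=\inf\Bigl\{\Bigl(\mathbb E\bigl\|Y_d-\textstyle\sum_{m=1}^n(Y_d,\psi_m)\psi_m\bigr\|^2\Bigr)^{1/2}:\ \psi_1,\dots,\psi_n\in L_2([0,1]^d)\Bigr\}.$$ Assume that for every $j$ the function identically equal to $1$ is an eigenvector of the covariance operator $K^{X_j}f(t)=\int_0^1\mathcal K^{X_j}(t,s)f(s)\,ds$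 on $L_2([0,1])$, with eigenvalue $\tilde\lambda_0^{X_j}$. Let $\Lambda^{X_j}$ be the sum of all eigenvalues of $K^{X_j}$ (with multiplicity), let $\tilde\lambda^{X_j}_1\ge\tilde\lambda^{X_j}_2\ge\dots$ be the remaining eigenvalues, i.e. those belonging to eigenvectors orthogonal to $1$, counted with multiplicity and continued by zeros if necessary, and let $\tilde\Lambda^{X_j}=\sum_{k\ge1}\tilde\lambda_k^{X_j}$. Assume: 1. for some $\varepsilon_0\in(0,1]$, $\displaystyle\lim_{d\to\infty}\frac{\sum_{j=1}^d\tilde\lambda_0^{X_j}}{\sum_{j=1}^d\Lambda^{X_j}}=1-\varepsilon_0^2$ (that is, the limit exists and is strictly less than $1$); 2. $\displaystyle\max_{1\le j\le d}\tilde\lambda_1^{X_j}=o\Bigl(\sum_{j=1}^d\tilde\Lambda^{X_j}\Bigr)$ as $d\to\infty$. A distribution function is a non-decreasing right-continuous function on $\mathbb R$ with limits $0$ at $-\infty$ and $1$ at $+\infty$. Suppose that, with a distribution function $U$ and a monotone real sequence $(\ell_j)$, $$\frac1{\tilde\Lambda^{X_j}}\sum_{k=1}^\infty\tilde\lambda_k^{X_j}\,\mathbf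 1\bigl(-\ln\tilde\lambda_k^{X_j}-\ell_j\le x\bigr)\to U(x),\qquad j\to\infty,$$ at every continuity point $x$ of $U$. Let $s=1$ if $(\ell_j)$ is non-decreasing and $s=-1$ if it is non-increasing. Suppose further that, with a distribution function $W$ and a real sequence $(a_d)$, $$\frac{\sum_{j=1}^d\tilde\Lambda^{X_j}\,\mathbf 1\bigl(s\cdot(\ell_j-a_d)\le x\bigr)}{\sum_{m=1}^d\tilde\Lambda^{X_m}}\to W(x),\qquad d\to\infty,$$ at every continuity point $x$ of $W$. Then for every $\varepsilon\in(0,\varepsilon_0)$ $$n^{Y_d}(\varepsilon)\sim e^{a_d}\sum_{j=1}^d\tilde\Lambda^{X_j}\int_0^{1-(\varepsilon/\varepsilon_0)^2}\exp\{F^{-1}(y)\}\,dy,\qquad d\to\infty,$$ where $F(x)=\int_{-\infty}^\infty U(x-s\cdot v)\,dW(v)$, $F^{-1}(y)=\inf\{x\in\mathbb R:F(x)\ge y\}$, and $\sim$ means that the ratio of the two sides tends to $1$. -/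

import Mathlib

open MeasureTheory ProbabilityTheory Filter Topology
open scoped unitInterval

noncomputable section

/-- A centered second-order random field `Z(t)`, `t ∈ T`, on the probability space `(Ω, P)`. -/
structure IsCenteredField {Ω T : Type*} [MeasurableSpace Ω] (P : Measure Ω)
    (Z : Ω → T → ℝ) : Prop where
  memLp : ∀ t, MemLp (fun ω => Z ω t) 2 P
  mean_zero : ∀ t, ∫ ω, Z ω t ∂P = 0

/-- The covariance function of `Z`. -/
def covFunc {Ω T : Type*} [MeasurableSpace Ω] (P : Measure Ω) (Z : Ω → T → ℝ) (t s : T) : ℝ :=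
  cov[fun ω => Z ω t, fun ω => Z ω s; P]

section Eigenvalues

/-- `f ∈ L₂(T)` satisfies `∫ K(t,s) f(s) ds = ν f(t)` for almost every `t` (`f = 0` is allowed). -/
def IsEigenfunction {T : Type*} [MeasureSpace T] (K : T → T → ℝ) (ν : ℝ)
    (f : Lp ℝ 2 (volume : Measure T)) : Prop :=
  ∀ᵐ t ∂(volume : Measure T), ∫ s, K t s * f s = ν * f t

/-- The non-increasing sequence (indexed from `0`) of the positive eigenvalues, counted with
multiplicity, that the integral operator with kernel `K` has on eigenfunctions belonging to `A`,
continued by zeros when there are only finitely many of them: the `k`-th term is the largest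
`μ > 0` such that at least `k + 1` linearly independent eigenfunctions in `A` have eigenvalues
`≥ μ`. -/
def eigenvalueSeq {T : Type*} [MeasureSpace T] (K : T → T → ℝ)
    (A : Set (Lp ℝ 2 (volume : Measure T))) (k : ℕ) : ℝ :=
  sSup {μ : ℝ | 0 < μ ∧ ((k : Cardinal) + 1 ≤
    Module.rank ℝ (Submodule.span ℝ {f | f ∈ A ∧ ∃ ν, μ ≤ ν ∧ IsEigenfunction K ν f}))}

/-- The function identically equal to `1` in `L₂([0,1])`. -/
def oneL2 : Lp ℝ 2 (volume : Measure I) := Lp.const 2 volume 1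

/-- All eigenvalues `λ₁ ≥ λ₂ ≥ …` of the operator with kernel `K` on `L₂([0,1])`. -/
def lamSeq (K : I → I → ℝ) : ℕ → ℝ := eigenvalueSeq K Set.univ

/-- When the function `1` is an eigenvector: the eigenvalues remaining after its
(one-dimensional) contribution is removed, i.e. those of the eigenfunctions orthogonal to `1`. -/
def tlamSeq (K : I → I → ℝ) : ℕ → ℝ := eigenvalueSeq K {f | inner ℝ oneL2 f = 0}

/-- The trace, the sum of all eigenvalues. -/
def lamTrace (K : I → I → ℝ) : ℝ := ∑' k, lamSeq K k

/-- The sum of the eigenvalues remaining after that of the function `1` is removed. -/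
def tlamTrace (K : I → I → ℝ) : ℝ := ∑' k, tlamSeq K k

end Eigenvalues

section Complexity

/-- `e(n)`: the infimum of `(E ‖Y - ∑_{m ≤ n} (Y, ψ_m) ψ_m‖²)^{1/2}` over all
`ψ_1, …, ψ_n ∈ L₂(T)`, as an extended nonnegative number. -/
def minAvgError {Ω T : Type*} [MeasurableSpace Ω] [MeasureSpace T] (P : Measure Ω)
    (Y : Ω → T → ℝ) (n : ℕ) : ENNReal :=
  ⨅ ψ : Fin n → Lp ℝ 2 (volume : Measure T),
    (∫⁻ ω, eLpNorm (fun t => Y ω t - ∑ m, (∫ s, Y ω s * ψ m s) * ψ m t) 2 volume ^ 2 ∂P)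
      ^ (1 / 2 : ℝ)

/-- The average case approximation complexity: the least positive integer `n` with
`e(n) ≤ ε e(0)`. -/
def approxComplexity {Ω T : Type*} [MeasurableSpace Ω] [MeasureSpace T] (P : Measure Ω)
    (Y : Ω → T → ℝ) (ε : ℝ) : ℕ :=
  sInf {n : ℕ | 1 ≤ n ∧ minAvgError P Y n ≤ ENNReal.ofReal ε * minAvgError P Y 0}

end Complexity

/-- The generalized inverse `inf {x : F(x) ≥ y}`. -/
def genInverse (F : ℝ → ℝ) (y : ℝ) : ℝ := sInf {x : ℝ | y ≤ F x}

/-- A distribution function on `ℝ`: a non-decreasing right-continuous function with limits `0`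
at `-∞` and `1` at `∞`. -/
def IsDistributionFunction (F : StieltjesFunction ℝ) : Prop :=
  Tendsto F atBot (𝓝 0) ∧ Tendsto F atTop (𝓝 1)

end

/-! The error of the best `n`-term approximation is governed by the spectrum of the covariance
operator. As the constant 1 is an eigenfunction of every marginal operator, functions of different
coordinates that are orthogonal to 1 are orthogonal on the cube, and the covariance operator of Y_d
becomes diagonal: the constant has eigenvalue c_d = ∑ λ̃₀, every remaining marginal eigenfunction,
read as a function of t_j, keeps its eigenvalue, and on the rest the operator vanishes
(`additive_eigenvalue_bounds`). The constant costs at most one function. Hence, up to a bounded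
error, n(ε) is the number of largest remaining eigenvalues whose sum reaches R_d = S_d − ε²(c_d +
S_d), with S_d = ∑ Λ̃_j, and condition 1 gives R_d/S_d → q = 1 − (ε/ε₀)².

Put mass λ/S_d at the point −ln λ − a_d for each remaining eigenvalue λ. This is a mixture over j of
the marginal distributions centered at ℓ_j, shifted by ℓ_j − a_d. Since S_d → ∞, finitely many j do
not matter, and characteristic functions show weak convergence to the convolution of U with the law
of s·v, v distributed as W; its distribution function is F (`tendsto_eigenvalue_average`). Because 1
= e^{a_d} λ exp(−ln λ − a_d), counting eigenvalues is integrating e^{a_d} S_d eˣ against this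
measure. Large eigenvalues lie on the left, so the count is asymptotically e^{a_d} S_d times the
integral of eˣ over the lower q-part of F, that is, of exp F⁻¹ over (0, q).

Weak convergence allows only bounded continuous test functions, so the count is squeezed by duality
(`tendsto_count_div`). From below, R_d ≤ ∑ (λ − τ)⁺ + τ n for every τ > 0; the choice τ = exp(−a_d −
F⁻¹(q)) leads to the test function (1 − exp(x − F⁻¹(q)))⁺. From above, a continuous cut-off of mass
slightly more than q, vanishing far to the right, is a fractional selection of eigenvalues, rounded
to a genuine one at the cost of one element. Such bounded costs vanish because condition 2 forces
e^{a_d} S_d → ∞. -/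

noncomputable section

/-! ### Spectral theorem with a prescribed eigenvector. -/

/-- A compact symmetric operator has a Hilbert basis of eigenvectors containing any given
normalized eigenvector. -/
theorem exists_hilbertBasis_eigenvectors {H : Type} [NormedAddCommGroup H] [InnerProductSpace ℝ H]
    [CompleteSpace H] (T : H →L[ℝ] H) (hc : IsCompactOperator T)
    (hs : (T : H →ₗ[ℝ] H).IsSymmetric) (u : H) (hu : ‖u‖ = 1) (c : ℝ) (hTu : T u = c • u) :
    ∃ (ι : Type) (b : HilbertBasis ι ℝ H) (ν : ι → ℝ) (i₀ : ι),
      b i₀ = u ∧ ∀ i, T (b i) = ν i • b i := by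
  classical
  let E : ℝ → Submodule ℝ H := fun μ => Module.End.eigenspace (T : Module.End ℝ H) μ
  have hmem : ∀ μ x, x ∈ E μ ↔ T x = μ • x := fun μ x => Module.End.mem_eigenspace_iff
  have hcl : ∀ μ, IsClosed (E μ : Set H) := by
    intro μ
    have : (E μ : Set H) = {x | T x = μ • x} := by ext x; exact hmem μ x
    rw [this]
    exact isClosed_eq T.continuous (continuous_const_smul μ)
  have : ∀ μ, CompleteSpace (E μ) := fun μ => (hcl μ).completeSpace_coe
  -- The set to be extended is a singleton when u lies in the eigenspace and empty otherwise, so all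
  -- eigenspaces are treated alike.
  have hbasis : ∀ μ, ∃ (w : Set (E μ)) (b : HilbertBasis w ℝ (E μ)),
      {x : E μ | (x : H) = u} ⊆ w ∧ ⇑b = ((↑) : w → E μ) := by
    intro μ
    apply Orthonormal.exists_hilbertBasis_extension
    refine ⟨fun x => ?_, fun x y hxy => ?_⟩
    · have h := x.2
      simp only [Set.mem_ofPred_eq] at h
      rw [← Submodule.norm_coe, h, hu]
    · exact absurd (Subtype.ext (Subtype.ext (x.2.trans y.2.symm))) hxy
  choose w b hw hb using hbasis
  have hON : Orthonormal ℝ (fun a : Σ μ, w μ => ((b a.1 a.2 : E a.1) : H)) :=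
    (hs.orthogonalFamily_eigenspaces).orthonormal_sigma_orthonormal
      (v_family := fun μ => ⇑(b μ)) (fun μ => (b μ).orthonormal)
  have hbot : (Submodule.span ℝ (Set.range (fun a : Σ μ, w μ => ((b a.1 a.2 : E a.1) : H))))ᗮ
      = ⊥ := by
    rw [Submodule.eq_bot_iff]
    intro x hx
    have hx' : x ∈ (⨆ μ, E μ)ᗮ := by
      rw [← Submodule.iInf_orthogonal, Submodule.mem_iInf]
      intro μ
      rw [Submodule.mem_orthogonal']
      intro y hy
      have h1 := ((b μ).hasSum_repr ⟨y, hy⟩).mapL ((innerSL ℝ x).comp (E μ).subtypeL)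
      have h2 : ∀ i, ((innerSL ℝ x).comp (E μ).subtypeL)
          ((b μ).repr ⟨y, hy⟩ i • (b μ) i) = 0 := by
        intro i
        have := (Submodule.mem_orthogonal' _ _).1 hx _
          (Submodule.subset_span (Set.mem_range_self (⟨μ, i⟩ : Σ μ, w μ)))
        simp only [ContinuousLinearMap.comp_apply, map_smul, Submodule.subtypeL_apply,
          innerSL_apply_apply, smul_eq_mul] at this ⊢
        rw [this, mul_zero]
      simp only [h2] at h1
      simpa using (h1.unique hasSum_zero)
    rw [show (⨆ μ, E μ)ᗮ = ⊥ from
      ContinuousLinearMap.orthogonalComplement_iSup_eigenspaces_eq_bot hc hs] at hx'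
    simpa using hx'
  have hu1 : u ∈ E c := (hmem c u).2 hTu
  refine ⟨Σ μ, w μ, HilbertBasis.mkOfOrthogonalEqBot hON hbot, fun a => a.1,
    ⟨c, ⟨⟨u, hu1⟩, hw c rfl⟩⟩, ?_, ?_⟩
  · simp [hb]
  · intro a
    simp only [HilbertBasis.coe_mkOfOrthogonalEqBot]
    exact (hmem _ _).1 (b a.1 a.2).2

/-! ### Decreasing enumeration of eigenvalues through counting functions. -/

/-- Just above a positive height the superlevel sets are constant when they are finite. -/
theorem exists_superlevel_gap {γ : Type*} (k : γ → ℝ) (hk : ∀ μ, 0 < μ → {a | μ ≤ k a}.Finite)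
    (x : ℝ) (hx : 0 < x) :
    ∃ y, x < y ∧ ∀ z, x < z → z ≤ y → {a | z ≤ k a} = {a | x < k a} := by
  have hfin : ({a | x < k a} : Set γ).Finite := (hk x hx).subset
    fun a (ha : x < k a) => show x ≤ k a from ha.le
  -- Take for y the least value of k above x, or x + 1 if there is none.
  obtain ⟨y, hy1, hy2⟩ : ∃ y, x < y ∧ ∀ a ∈ {a | x < k a}, y ≤ k a := by
    rcases Set.eq_empty_or_nonempty {a | x < k a} with h0 | h0
    · exact ⟨x + 1, by linarith, by simp [h0]⟩
    · obtain ⟨a, ha, hmin⟩ := Set.exists_min_image _ k hfin h0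
      exact ⟨k a, ha, hmin⟩
  refine ⟨y, hy1, fun z hz hzy => ?_⟩
  ext a
  exact ⟨fun ha => lt_of_lt_of_le hz ha, fun ha => hzy.trans (hy2 a ha)⟩

theorem ncard_fiber_eq_sub {γ : Type*} (k : γ → ℝ) (hk : ∀ μ, 0 < μ → {a | μ ≤ k a}.Finite)
    (x : ℝ) (hx : 0 < x) :
    {a | k a = x}.ncard = {a | x ≤ k a}.ncard - {a | x < k a}.ncard := by
  have hsub : ({a | x < k a} : Set γ) ⊆ {a | x ≤ k a} :=
    fun a (ha : x < k a) => show x ≤ k a from ha.le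
  rw [← Set.ncard_sdiff hsub ((hk x hx).subset hsub)]
  congr 1
  ext a
  simp only [Set.mem_ofPred_eq, Set.mem_sdiff, not_lt]
  exact ⟨fun h => ⟨h.ge, h.le⟩, fun h => le_antisymm h.2 h.1⟩

/-- Two functions whose superlevel sets at positive heights are finite and equinumerous agree,
where positive, up to a bijection. -/
theorem exists_equiv_of_ncard_superlevel_eq {α β : Type*} (f : α → ℝ) (g : β → ℝ)
    (hf : ∀ μ, 0 < μ → {a | μ ≤ f a}.Finite) (hg : ∀ μ, 0 < μ → {b | μ ≤ g b}.Finite)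
    (h : ∀ μ, 0 < μ → {a | μ ≤ f a}.ncard = {b | μ ≤ g b}.ncard) :
    ∃ e : {a // 0 < f a} ≃ {b // 0 < g b}, ∀ a, g (e a) = f a := by
  -- Strict superlevel sets at x are weak ones at a common height slightly above x; differences of
  -- the two counts then give the sizes of the fibers.
  have hlt : ∀ x, 0 < x → {a | x < f a}.ncard = {b | x < g b}.ncard := by
    intro x hx
    obtain ⟨y1, h1, h1'⟩ := exists_superlevel_gap f hf x hx
    obtain ⟨y2, h2, h2'⟩ := exists_superlevel_gap g hg x hx
    have hz : x < min y1 y2 := lt_min h1 h2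
    rw [← h1' _ hz (min_le_left _ _), ← h2' _ hz (min_le_right _ _)]
    exact h _ (hx.trans hz)
  have heq : ∀ x, Nonempty
      ({a : {a // 0 < f a} // f a = x} ≃ {b : {b // 0 < g b} // g b = x}) := by
    intro x
    rcases le_or_gt x 0 with hx | hx
    · have e1 : IsEmpty {a : {a // 0 < f a} // f a = x} :=
        ⟨fun a => by have := a.1.2; rw [a.2] at this; linarith⟩
      have e2 : IsEmpty {a : {a // 0 < g a} // g a = x} :=
        ⟨fun a => by have := a.1.2; rw [a.2] at this; linarith⟩
      exact ⟨Equiv.equivOfIsEmpty _ _⟩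
    · have hc : {a | f a = x}.ncard = {b | g b = x}.ncard := by
        rw [ncard_fiber_eq_sub f hf x hx, ncard_fiber_eq_sub g hg x hx, h x hx, hlt x hx]
      have fin1 : Finite {a // f a = x} :=
        ((hf x hx).subset (fun a (ha : f a = x) => ha.ge) : {a | f a = x}.Finite)
      have fin2 : Finite {a // g a = x} :=
        ((hg x hx).subset (fun a (ha : g a = x) => ha.ge) : {a | g a = x}.Finite)
      have e : {a // f a = x} ≃ {b // g b = x} :=
        ((Finite.card_eq (α := {a // f a = x}) (β := {b // g b = x})).1 hc).some
      exact ⟨((Equiv.subtypeSubtypeEquivSubtype (fun {a} (ha : f a = x) => by rw [ha]; exact hx)).trans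
        e).trans (Equiv.subtypeSubtypeEquivSubtype
          (fun {a} (ha : g a = x) => by rw [ha]; exact hx)).symm⟩
  refine ⟨Equiv.ofFiberEquiv (f := fun a : {a // 0 < f a} => f a)
    (g := fun b : {b // 0 < g b} => g b) (fun x => (heq x).some), fun a => ?_⟩
  exact Equiv.ofFiberEquiv_map (f := fun a : {a // 0 < f a} => f a)
    (g := fun b : {b // 0 < g b} => g b) (fun x => (heq x).some) a

/-- The sequence of the values of a function with finite superlevel sets, in decreasing order. -/
theorem exists_equiv_sSup_ncard {ι : Type*} (ν : ι → ℝ) (hν : ∀ μ, 0 < μ → {i | μ ≤ ν i}.Finite)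
    (s : ℕ → ℝ) (hs : ∀ k, s k = sSup {μ | 0 < μ ∧ k + 1 ≤ {i | μ ≤ ν i}.ncard}) :
    (∀ k, 0 ≤ s k) ∧ Antitone s ∧
      ∃ e : {k // 0 < s k} ≃ {i // 0 < ν i}, ∀ k, ν (e k) = s k := by
  have hbdd : ∀ k : ℕ, BddAbove {μ | 0 < μ ∧ k + 1 ≤ {i | μ ≤ ν i}.ncard} := by
    intro k
    obtain ⟨B, hB⟩ := ((hν 1 one_pos).image ν).bddAbove
    refine ⟨max 1 B, fun μ hμ => ?_⟩
    obtain ⟨i, hi⟩ : {i | μ ≤ ν i}.Nonempty :=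
      Set.nonempty_of_ncard_ne_zero (by have := hμ.2; omega)
    rcases le_or_gt μ 1 with h | h
    · exact h.trans (le_max_left _ _)
    · exact (le_trans hi (hB ⟨i, h.le.trans hi, rfl⟩)).trans (le_max_right _ _)
  have key : ∀ k μ, 0 < μ → (μ ≤ s k ↔ k + 1 ≤ {i | μ ≤ ν i}.ncard) := by
    intro k μ hμ
    constructor
    · intro h
      have hfin : {i | μ / 2 ≤ ν i}.Finite := hν _ (by linarith)
      -- Only finitely many values lie in [μ/2, μ), so some y < μ leaves none in (y, μ). Any height
      -- above y then has at most the count at μ, which makes the supremum attained.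
      obtain ⟨y, hy0, hy1, hy2⟩ : ∃ y, 0 < y ∧ y < μ ∧ ∀ i, y < ν i → μ ≤ ν i := by
        let A := {i | μ / 2 ≤ ν i ∧ ν i < μ}
        have hA : A.Finite := hfin.subset fun i hi => hi.1
        rcases Set.eq_empty_or_nonempty A with h0 | h0
        · refine ⟨μ / 2, by linarith, by linarith, fun i hi => ?_⟩
          by_contra hlt
          have : i ∈ A := ⟨hi.le, not_le.1 hlt⟩
          simp [h0] at this
        · obtain ⟨a, ha, hmax⟩ := Set.exists_max_image _ ν hA h0
          refine ⟨ν a, by have := ha.1; linarith, ha.2, fun i hi => ?_⟩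
          by_contra hlt
          have := hmax i ⟨ha.1.trans hi.le, not_le.1 hlt⟩
          linarith
      -- The supremum of the empty set is 0, which contradicts 0 < μ ≤ s k; the same default
      -- continues the sequence by zeros.
      have hne : {μ | 0 < μ ∧ k + 1 ≤ {i | μ ≤ ν i}.ncard}.Nonempty := by
        by_contra hemp
        rw [Set.not_nonempty_iff_eq_empty] at hemp
        rw [hs, hemp, Real.sSup_empty] at h
        linarith
      obtain ⟨z, hz, hyz⟩ := exists_lt_of_lt_csSup hne (lt_of_lt_of_le hy1 (h.trans_eq (hs k)))
      refine hz.2.trans (Set.ncard_le_ncard (fun i hi => ?_) (hν μ hμ))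
      exact hy2 i (lt_of_lt_of_le hyz hi)
    · intro h
      rw [hs]
      exact le_csSup (hbdd k) ⟨hμ, h⟩
  have hset : ∀ μ, 0 < μ → {k | μ ≤ s k} = Set.Iio ({i | μ ≤ ν i}.ncard) := by
    intro μ hμ
    ext k
    simp only [Set.mem_ofPred_eq, key k μ hμ, Set.mem_Iio]
    omega
  refine ⟨fun k => ?_, fun k l hkl => ?_, ?_⟩
  · rw [hs]
    exact Real.sSup_nonneg fun x hx => hx.1.le
  · rw [hs, hs]
    rcases Set.eq_empty_or_nonempty {μ | 0 < μ ∧ l + 1 ≤ {i | μ ≤ ν i}.ncard} with h0 | h0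
    · rw [h0, Real.sSup_empty]
      exact Real.sSup_nonneg fun x hx => hx.1.le
    · exact csSup_le_csSup (hbdd k) h0 fun x hx => ⟨hx.1, by have := hx.2; omega⟩
  · refine exists_equiv_of_ncard_superlevel_eq s ν (fun μ hμ => ?_) hν (fun μ hμ => ?_)
    · rw [hset μ hμ]; exact Set.finite_Iio _
    · rw [hset μ hμ, Set.ncard_eq_toFinset_card']
      simp

/-- When a Hilbert basis of eigenvectors is known, the sequence `eigenvalueSeq` lists the positive
eigenvalues of the basis vectors which are not orthogonal to the subspace under consideration. -/
theorem eigenvalueSeq_rearrangement {T : Type} [MeasureSpace T] (K : T → T → ℝ)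
    (L : Lp ℝ 2 (volume : Measure T) →L[ℝ] Lp ℝ 2 (volume : Measure T))
    (hL : ∀ ν f, IsEigenfunction K ν f ↔ L f = ν • f)
    (hs : (L : Lp ℝ 2 (volume : Measure T) →ₗ[ℝ] Lp ℝ 2 (volume : Measure T)).IsSymmetric)
    {ι : Type} (b : HilbertBasis ι ℝ (Lp ℝ 2 (volume : Measure T))) (ν : ι → ℝ)
    (hb : ∀ i, L (b i) = ν i • b i) (hfin : ∀ μ, 0 < μ → {i | μ ≤ ν i}.Finite) (J : Set ι)
    (A : Set (Lp ℝ 2 (volume : Measure T)))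
    (hA : ∀ f, f ∈ A ↔ ∀ i ∉ J, inner ℝ (b i) f = 0) :
    (∀ k, 0 ≤ eigenvalueSeq K A k) ∧ Antitone (eigenvalueSeq K A) ∧
      ∃ e : {k // 0 < eigenvalueSeq K A k} ≃ {i : J // 0 < ν i},
        ∀ k, ν (e k).1 = eigenvalueSeq K A k := by
  have hfinJ : ∀ μ, 0 < μ → {i : J | μ ≤ ν i}.Finite := fun μ hμ =>
    Set.Finite.preimage (s := {i | μ ≤ ν i}) Subtype.val_injective.injOn (hfin μ hμ)
  refine exists_equiv_sSup_ncard (fun i : J => ν i) hfinJ _ fun k => ?_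
  unfold eigenvalueSeq
  congr 1
  ext μ
  refine and_congr_right fun hμ => ?_
  have hspan : Submodule.span ℝ {f | f ∈ A ∧ ∃ ν, μ ≤ ν ∧ IsEigenfunction K ν f} =
      Submodule.span ℝ ((fun i : J => b i) '' {i : J | μ ≤ ν i}) := by
    apply le_antisymm
    · refine Submodule.span_le.2 ?_
      rintro f ⟨hfA, ν', hν', hf⟩
      rw [hL] at hf
      -- Symmetry gives ν i ⟨b i, f⟩ = ν' ⟨b i, f⟩, so f only involves basis vectors with the same
      -- eigenvalue ν' ≥ μ. There are finitely many of these, hence f is in their algebraic span.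
      have hin : ∀ i, inner ℝ (b i) f ≠ 0 → i ∈ J ∧ ν i = ν' := by
        intro i hi
        refine ⟨by_contra fun hJ => hi ((hA f).1 hfA i hJ), ?_⟩
        have h1 := hs (b i) f
        simp only [ContinuousLinearMap.coe_coe, hb, hf, inner_smul_left, inner_smul_right] at h1
        exact mul_right_cancel₀ hi (by simpa using h1)
      have hsupp : Function.support (fun i => b.repr f i • b i) ⊆ {i | μ ≤ ν i} := by
        intro i hi
        have : inner ℝ (b i) f ≠ 0 := by
          intro h0
          apply hi
          simp [b.repr_apply_apply, h0]
        have h2 := (hin i this).2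
        show μ ≤ ν i
        rw [h2]; exact hν'
      have hfs := (hfin μ hμ).subset hsupp
      have heq : f = ∑ i ∈ hfs.toFinset, b.repr f i • b i := by
        refine (b.hasSum_repr f).unique (hasSum_sum_of_ne_finset_zero fun i hi => ?_)
        by_contra h0
        exact hi (hfs.mem_toFinset.2 h0)
      rw [SetLike.mem_coe, heq]
      refine Submodule.sum_mem _ fun i hi => Submodule.smul_mem _ _ (Submodule.subset_span ?_)
      have hi' : i ∈ Function.support (fun i => b.repr f i • b i) := by simpa using hi
      have : inner ℝ (b i) f ≠ 0 := by
        intro h0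
        apply hi'
        simp [b.repr_apply_apply, h0]
      exact ⟨⟨i, (hin i this).1⟩, hsupp hi', rfl⟩
    · refine Submodule.span_mono ?_
      rintro _ ⟨i, hi, rfl⟩
      refine ⟨(hA _).2 fun j hj => b.orthonormal.2 fun h => hj (h ▸ i.2), ν i, hi, ?_⟩
      rw [hL, hb]
  have hli : LinearIndepOn ℝ (fun i : J => b i) {i : J | μ ≤ ν i} :=
    (b.orthonormal.linearIndependent.comp (fun i : J => (i : ι))
      Subtype.val_injective).linearIndepOn _
  rw [hspan, rank_span_set hli.id_image,
    Cardinal.mk_image_eq (f := fun i : J => b i)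
      (b.orthonormal.linearIndependent.injective.comp Subtype.val_injective)]
  have hf := hfinJ μ hμ
  have : Cardinal.mk {i : J | μ ≤ ν i} = ({i : J | μ ≤ ν i}.ncard : Cardinal) := by
    rw [← Set.cast_ncard hf]
  rw [this]
  norm_cast

/-! ### Integral operators with continuous covariance kernels. -/

/-- The sections `K(t, ·)` of a continuous kernel as a continuous map into `L₂([0,1])`. -/
def kernelSection (K : I → I → ℝ) (hK : Continuous (Function.uncurry K)) :
    C(I, Lp ℝ 2 (volume : Measure I)) :=
  ⟨fun t => ContinuousMap.toLp (E := ℝ) 2 (volume : Measure I) ℝ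
    (ContinuousMap.curry ⟨Function.uncurry K, hK⟩ t), by fun_prop⟩

theorem coeFn_kernelSection (K : I → I → ℝ) (hK : Continuous (Function.uncurry K)) (t : I) :
    kernelSection K hK t =ᵐ[volume] K t :=
  ContinuousMap.coeFn_toLp (p := 2) (𝕜 := ℝ) (volume : Measure I)
    (ContinuousMap.curry ⟨Function.uncurry K, hK⟩ t)

theorem L2_inner_eq_integral_mul {T : Type*} [MeasureSpace T]
    (f g : Lp ℝ 2 (volume : Measure T)) : inner ℝ f g = ∫ t, f t * g t := by
  rw [L2.inner_def]
  exact integral_congr_ae (.of_forall fun t => by simp [mul_comm])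

theorem inner_kernelSection (K : I → I → ℝ) (hK : Continuous (Function.uncurry K)) (t : I)
    (f : Lp ℝ 2 (volume : Measure I)) :
    inner ℝ (kernelSection K hK t) f = ∫ s, K t s * f s := by
  rw [L2_inner_eq_integral_mul]
  refine integral_congr_ae ?_
  filter_upwards [coeFn_kernelSection K hK t] with s hs
  rw [hs]

/-- The map `f ↦ (t ↦ ∫ K(t,s) f(s) ds)` from `L₂([0,1])` to bounded continuous functions. -/
def kernelOpBCF (K : I → I → ℝ) (hK : Continuous (Function.uncurry K)) :
    Lp ℝ 2 (volume : Measure I) →L[ℝ] BoundedContinuousFunction I ℝ :=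
  LinearMap.mkContinuous
    { toFun := fun f => BoundedContinuousFunction.mkOfCompact
        ⟨fun t => inner ℝ (kernelSection K hK t) f, by fun_prop⟩
      map_add' := fun f g => by ext t; simp [inner_add_right]
      map_smul' := fun c f => by ext t; simp [inner_smul_right] } ‖kernelSection K hK‖
    (fun f => by
      refine (BoundedContinuousFunction.norm_le (by positivity)).2 fun t => ?_
      refine (norm_inner_le_norm (𝕜 := ℝ) (kernelSection K hK t) f).trans ?_
      gcongr
      exact ContinuousMap.norm_coe_le_norm _ t)

/-- By Cauchy–Schwarz the images of the unit ball are bounded by the supremum of ‖K(t, ·)‖, and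
their increments by ‖K(t, ·) − K(t₀, ·)‖; Arzelà–Ascoli applies. -/
theorem isCompactOperator_kernelOpBCF (K : I → I → ℝ) (hK : Continuous (Function.uncurry K)) :
    IsCompactOperator (kernelOpBCF K hK) := by
  rw [← ContinuousLinearMap.coe_coe,
    isCompactOperator_iff_isCompact_closure_image_closedBall (𝕜₁ := ℝ) _ one_pos]
  refine BoundedContinuousFunction.arzela_ascoli (Metric.closedBall 0 ‖kernelSection K hK‖)
    (isCompact_closedBall _ _) _ ?_ ?_
  · rintro _ t ⟨f, hf, rfl⟩
    rw [mem_closedBall_zero_iff] at hf ⊢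
    refine (norm_inner_le_norm (𝕜 := ℝ) (kernelSection K hK t) f).trans ?_
    have := ContinuousMap.norm_coe_le_norm (kernelSection K hK) t
    nlinarith [norm_nonneg (kernelSection K hK t), norm_nonneg f]
  · intro t₀
    rw [Metric.equicontinuousAt_iff]
    intro ε hε
    obtain ⟨δ, hδ, h⟩ := Metric.continuousAt_iff.1
      ((kernelSection K hK).continuous.continuousAt (x := t₀)) ε hε
    refine ⟨δ, hδ, fun t ht => ?_⟩
    rintro ⟨_, f, hf, rfl⟩
    rw [mem_closedBall_zero_iff] at hf
    have h2 := h ht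
    show dist (inner ℝ (kernelSection K hK t₀) f) (inner ℝ (kernelSection K hK t) f) < ε
    rw [dist_comm, Real.dist_eq, ← inner_sub_left]
    rw [dist_eq_norm] at h2
    refine lt_of_le_of_lt (abs_real_inner_le_norm _ _) ?_
    nlinarith [norm_nonneg (kernelSection K hK t - kernelSection K hK t₀), norm_nonneg f]

/-- The integral operator with a continuous kernel on `L₂([0,1])`. -/
def kernelOp (K : I → I → ℝ) (hK : Continuous (Function.uncurry K)) :
    Lp ℝ 2 (volume : Measure I) →L[ℝ] Lp ℝ 2 (volume : Measure I) :=
  (BoundedContinuousFunction.toLp (E := ℝ) 2 (volume : Measure I) ℝ).comp (kernelOpBCF K hK)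

theorem coeFn_kernelOp (K : I → I → ℝ) (hK : Continuous (Function.uncurry K))
    (f : Lp ℝ 2 (volume : Measure I)) :
    kernelOp K hK f =ᵐ[volume] fun t => inner ℝ (kernelSection K hK t) f :=
  BoundedContinuousFunction.coeFn_toLp (p := 2) (𝕜 := ℝ) (volume : Measure I) (kernelOpBCF K hK f)

theorem isCompactOperator_kernelOp (K : I → I → ℝ) (hK : Continuous (Function.uncurry K)) :
    IsCompactOperator (kernelOp K hK) :=
  (isCompactOperator_kernelOpBCF K hK).clm_comp
    (BoundedContinuousFunction.toLp (E := ℝ) 2 (volume : Measure I) ℝ)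

theorem isEigenfunction_iff_kernelOp (K : I → I → ℝ) (hK : Continuous (Function.uncurry K))
    (ν : ℝ) (f : Lp ℝ 2 (volume : Measure I)) :
    IsEigenfunction K ν f ↔ kernelOp K hK f = ν • f := by
  rw [Lp.ext_iff]
  unfold IsEigenfunction
  simp_rw [← inner_kernelSection K hK]
  constructor
  · intro h
    filter_upwards [h, coeFn_kernelOp K hK f, Lp.coeFn_smul ν f] with t h1 h2 h3
    rw [h2, h1, h3]; rfl
  · intro h
    filter_upwards [h, coeFn_kernelOp K hK f, Lp.coeFn_smul ν f] with t h1 h2 h3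
    rw [← h2, h1, h3]; rfl

theorem covFunc_eq_integral {Ω T : Type*} [MeasurableSpace Ω] {P : Measure Ω} {Z : Ω → T → ℝ}
    (hZ : IsCenteredField P Z) (t s : T) : covFunc P Z t s = ∫ ω, Z ω t * Z ω s ∂P := by
  simp [covFunc, covariance, hZ.mean_zero]

/-- The random variables of a process as elements of `L₂(P)`. -/
def fieldLp {Ω' : Type*} [MeasurableSpace Ω'] (P : Measure Ω')
    (X : Ω' → I → ℝ) (hX : IsCenteredField P X) (t : I) : Lp ℝ 2 P := (hX.memLp t).toLp _

theorem inner_fieldLp {Ω' : Type*} [MeasurableSpace Ω'] (P : Measure Ω')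
    (X : Ω' → I → ℝ) (hX : IsCenteredField P X) (t s : I) :
    inner ℝ (fieldLp P X hX t) (fieldLp P X hX s) = covFunc P X t s := by
  rw [covFunc_eq_integral hX, L2.inner_def]
  refine integral_congr_ae ?_
  filter_upwards [(hX.memLp t).coeFn_toLp, (hX.memLp s).coeFn_toLp] with ω h1 h2
  simp only [fieldLp, h1, h2]
  simp [mul_comm]

/-- Mean-square continuity: the squared increment is K(s,s) − 2K(s,t) + K(t,t), which tends to 0 as
s → t. -/
theorem continuous_fieldLp {Ω' : Type*} [MeasurableSpace Ω'] (P : Measure Ω')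
    (X : Ω' → I → ℝ) (hX : IsCenteredField P X)
    (hK : Continuous (Function.uncurry (covFunc P X))) :
    Continuous (fieldLp P X hX) := by
  rw [continuous_iff_continuousAt]
  intro t
  rw [ContinuousAt, tendsto_iff_norm_sub_tendsto_zero]
  have h : ∀ s, ‖fieldLp P X hX s - fieldLp P X hX t‖ =
      √(covFunc P X s s - 2 * covFunc P X s t + covFunc P X t t) := by
    intro s
    rw [← inner_fieldLp P X hX, ← inner_fieldLp P X hX, ← inner_fieldLp P X hX,
      real_inner_self_eq_norm_sq, real_inner_self_eq_norm_sq, ← norm_sub_sq_real,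
      Real.sqrt_sq (norm_nonneg _)]
  simp_rw [h]
  have hc : Continuous fun s => √(covFunc P X s s - 2 * covFunc P X s t + covFunc P X t t) := by
    have h1 : Continuous fun s => covFunc P X s s := hK.comp (continuous_id.prodMk continuous_id)
    have h2 : Continuous fun s => covFunc P X s t :=
      hK.comp (continuous_id.prodMk continuous_const)
    fun_prop
  have := hc.tendsto t
  rwa [show covFunc P X t t - 2 * covFunc P X t t + covFunc P X t t = 0 by ring,
    Real.sqrt_zero] at this

theorem integrable_smul_fieldLp {Ω' : Type*} [MeasurableSpace Ω'] (P : Measure Ω')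
    (X : Ω' → I → ℝ) (hX : IsCenteredField P X)
    (hK : Continuous (Function.uncurry (covFunc P X)))
    (f : Lp ℝ 2 (volume : Measure I)) :
    Integrable (fun t => f t • fieldLp P X hX t) volume := by
  obtain ⟨C, hC⟩ := (isCompact_range (continuous_fieldLp P X hX hK)).isBounded.exists_norm_le
  refine Integrable.smul_bdd ((Lp.memLp f).integrable (by norm_num)) C
    (continuous_fieldLp P X hX hK).aestronglyMeasurable (.of_forall fun t => hC _ ⟨t, rfl⟩)

/-- The covariance operator is a Gram operator, whence its symmetry and positivity. The integrals of
f(t) X(t) are Bochner integrals in L₂(P): joint measurability of X is not assumed, so pathwise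
integrals are not available. -/
theorem inner_kernelOp_covFunc {Ω' : Type*} [MeasurableSpace Ω'] (P : Measure Ω')
    (X : Ω' → I → ℝ) (hX : IsCenteredField P X)
    (hK : Continuous (Function.uncurry (covFunc P X)))
    (f g : Lp ℝ 2 (volume : Measure I)) :
    inner ℝ (kernelOp (covFunc P X) hK f) g =
      inner ℝ (∫ t, f t • fieldLp P X hX t) (∫ t, g t • fieldLp P X hX t) := by
  rw [← integral_inner (integrable_smul_fieldLp P X hX hK g), L2_inner_eq_integral_mul]
  refine integral_congr_ae ?_
  filter_upwards [coeFn_kernelOp (covFunc P X) hK f] with t ht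
  rw [ht, inner_smul_right, mul_comm, inner_kernelSection, real_inner_comm,
    ← integral_inner (integrable_smul_fieldLp P X hX hK f)]
  congr 1
  refine integral_congr_ae (.of_forall fun s => ?_)
  simp only [inner_smul_right, inner_fieldLp]
  ring

theorem isSymmetric_kernelOp_covFunc {Ω' : Type*} [MeasurableSpace Ω'] (P : Measure Ω')
    (X : Ω' → I → ℝ) (hX : IsCenteredField P X)
    (hK : Continuous (Function.uncurry (covFunc P X))) :
    (kernelOp (covFunc P X) hK : Lp ℝ 2 (volume : Measure I) →ₗ[ℝ] _).IsSymmetric := by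
  intro f g
  simp only [ContinuousLinearMap.coe_coe]
  rw [inner_kernelOp_covFunc P X hX, real_inner_comm, ← inner_kernelOp_covFunc P X hX,
    real_inner_comm]

theorem inner_kernelOp_covFunc_nonneg {Ω' : Type*} [MeasurableSpace Ω'] (P : Measure Ω')
    (X : Ω' → I → ℝ) (hX : IsCenteredField P X)
    (hK : Continuous (Function.uncurry (covFunc P X)))
    (f : Lp ℝ 2 (volume : Measure I)) : 0 ≤ inner ℝ (kernelOp (covFunc P X) hK f) f := by
  rw [inner_kernelOp_covFunc P X hX]
  exact real_inner_self_nonneg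

theorem HasSum.of_forall_eq {ι : Type*} {f g : ι → ℝ} {a : ℝ} (h : HasSum f a)
    (hfg : ∀ i, f i = g i) : HasSum g a := by
  rwa [← funext hfg]

theorem norm_oneL2 : ‖oneL2‖ = 1 := by
  rw [oneL2, Lp.norm_const] <;> simp

theorem coeFn_oneL2 : oneL2 =ᵐ[volume] fun _ => (1 : ℝ) :=
  Lp.coeFn_const _ _ _

/-- The covariance operator of a process with continuous covariance function has a Hilbert basis of
eigenvectors containing the function `1`, when this function is an eigenvector. -/
theorem exists_marginal_basis {Ω' : Type*} [MeasurableSpace Ω'] (P : Measure Ω')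
    (X : Ω' → I → ℝ) (hX : IsCenteredField P X) (K : I → I → ℝ) (hKX : K = covFunc P X)
    (hK : Continuous (Function.uncurry K)) (lam0 : ℝ) (hlam0 : IsEigenfunction K lam0 oneL2) :
    ∃ (ι : Type) (b : HilbertBasis ι ℝ (Lp ℝ 2 (volume : Measure I))) (ν : ι → ℝ) (i₀ : ι),
      b i₀ = oneL2 ∧ ν i₀ = lam0 ∧ (∀ i, 0 ≤ ν i) ∧ (∀ i, kernelOp K hK (b i) = ν i • b i) ∧
      ∀ f, HasSum (fun i => ν i * (inner ℝ (b i) f) ^ 2) (inner ℝ (kernelOp K hK f) f) := by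
  subst hKX
  obtain ⟨ι, b, ν, i₀, h0, hb⟩ := exists_hilbertBasis_eigenvectors _
    (isCompactOperator_kernelOp _ hK) (isSymmetric_kernelOp_covFunc P X hX hK) oneL2 norm_oneL2 lam0
    ((isEigenfunction_iff_kernelOp _ hK _ _).1 hlam0)
  have hself : ∀ i, inner ℝ (b i) (b i) = 1 := fun i => by
    rw [real_inner_self_eq_norm_sq, b.orthonormal.1, one_pow]
  refine ⟨ι, b, ν, i₀, h0, ?_, fun i => ?_, hb, fun f => ?_⟩
  · have h1 := hb i₀
    rw [h0, (isEigenfunction_iff_kernelOp _ hK _ _).1 hlam0] at h1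
    have h2 := congrArg (fun x => inner ℝ oneL2 x) h1
    simp only [inner_smul_right, real_inner_self_eq_norm_sq, norm_oneL2] at h2
    linarith
  · have := inner_kernelOp_covFunc_nonneg P X hX hK (b i)
    rwa [hb, inner_smul_left, hself, mul_one] at this
  · have h := b.hasSum_inner_mul_inner (kernelOp (covFunc P X) hK f) f
    refine h.of_forall_eq fun i => ?_
    have := isSymmetric_kernelOp_covFunc P X hX hK f (b i)
    simp only [ContinuousLinearMap.coe_coe] at this
    rw [this, hb, inner_smul_right, real_inner_comm]
    ring

theorem finite_superlevel_of_summable {ι : Type*} {ν : ι → ℝ} (h : Summable ν) (μ : ℝ)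
    (hμ : 0 < μ) : {i | μ ≤ ν i}.Finite := by
  have := h.tendsto_cofinite_zero.eventually (gt_mem_nhds hμ)
  rw [eventually_cofinite] at this
  simpa only [not_lt] using this

/-- Expansion of the quadratic form of the covariance operator along the eigenvalues `tlamSeq`, and
the relation between the two traces. -/
theorem marginal_rearrangement (K : I → I → ℝ) (hK : Continuous (Function.uncurry K))
    (hs : (kernelOp K hK : Lp ℝ 2 (volume : Measure I) →ₗ[ℝ] _).IsSymmetric) {ι : Type}
    (b : HilbertBasis ι ℝ (Lp ℝ 2 (volume : Measure I))) (ν : ι → ℝ) (i₀ : ι)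
    (h0 : b i₀ = oneL2) (hν : ∀ i, 0 ≤ ν i) (hb : ∀ i, kernelOp K hK (b i) = ν i • b i)
    (hq : ∀ f, HasSum (fun i => ν i * (inner ℝ (b i) f) ^ 2) (inner ℝ (kernelOp K hK f) f))
    (hsum : Summable ν) :
    (∀ k, 0 ≤ tlamSeq K k) ∧ Antitone (tlamSeq K) ∧ Summable (tlamSeq K) ∧
      tlamTrace K + ν i₀ = ∑' i, ν i ∧ lamTrace K = ∑' i, ν i ∧
      ∃ v : {k // 0 < tlamSeq K k} → Lp ℝ 2 (volume : Measure I), Orthonormal ℝ v ∧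
        (∀ k, inner ℝ oneL2 (v k) = 0) ∧ ∀ f, HasSum
          (fun k : {k // 0 < tlamSeq K k} => tlamSeq K k * (inner ℝ (v k) f) ^ 2)
          (inner ℝ (kernelOp K hK f) f - ν i₀ * (inner ℝ oneL2 f) ^ 2) := by
  classical
  have hfin := finite_superlevel_of_summable hsum
  -- Sums over the whole basis may be computed along the enumeration, since the indices it misses
  -- are outside J or have ν i = 0, where the summand vanishes.
  have transfer : ∀ (J : Set ι) (s : ℕ → ℝ) (e : {k // 0 < s k} ≃ {i : J // 0 < ν i})
      (h0s : ∀ k, 0 ≤ s k) (he : ∀ k, ν (e k).1 = s k) (G : ι → ℝ) (a : ℝ)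
      (hG : HasSum G a) (hG0 : ∀ i, ν i = 0 → G i = 0) (hGJ : ∀ i ∉ J, G i = 0),
      HasSum (fun k => G (e k).1.1) a := by
    intro J s e h0s he G a hG hG0 hGJ
    have hinj : Function.Injective fun k => ((e k).1.1 : ι) := fun k l hkl =>
      e.injective (Subtype.ext (Subtype.ext hkl))
    refine (hinj.hasSum_iff fun i hi => ?_).2 hG
    by_contra hne
    have hJ : i ∈ J := by_contra fun h => hne (hGJ i h)
    have hp : 0 < ν i := lt_of_le_of_ne (hν i) fun h => hne (hG0 i h.symm)
    exact hi ⟨e.symm ⟨⟨i, hJ⟩, hp⟩, by simp⟩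
  have toNat : ∀ (s : ℕ → ℝ) (h0s : ∀ k, 0 ≤ s k) (a : ℝ),
      HasSum (fun k : {k // 0 < s k} => s k) a → HasSum s a := by
    intro s h0s a h
    refine (Subtype.val_injective.hasSum_iff fun k hk => ?_).1 h
    by_contra hne
    exact hk ⟨⟨k, lt_of_le_of_ne (h0s k) (Ne.symm hne)⟩, rfl⟩
  obtain ⟨u0, -, eu, heu⟩ := eigenvalueSeq_rearrangement K (kernelOp K hK)
    (isEigenfunction_iff_kernelOp K hK) hs b ν hb hfin Set.univ Set.univ (by simp)
  obtain ⟨t0, tanti, et, het⟩ := eigenvalueSeq_rearrangement K (kernelOp K hK)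
    (isEigenfunction_iff_kernelOp K hK) hs b ν hb hfin {i | i ≠ i₀}
    {f | inner ℝ oneL2 f = 0} (by simp [h0])
  -- The index of the constant is removed by subtracting its term, which leaves a summand on the
  -- full index set that vanishes outside J.
  have hminus : HasSum (fun i => ν i - if i = i₀ then ν i₀ else 0) (∑' i, ν i - ν i₀) :=
    hsum.hasSum.sub (hasSum_ite_eq i₀ (ν i₀))
  have h1 : HasSum (lamSeq K) (∑' i, ν i) := by
    refine toNat _ u0 _ ?_
    have := transfer Set.univ _ eu u0 heu ν _ hsum.hasSum (fun i hi => hi) (by simp)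
    simpa only [heu] using this
  have h2 : HasSum (tlamSeq K) (∑' i, ν i - ν i₀) := by
    refine toNat _ t0 _ ?_
    have := transfer _ _ et t0 het _ _ hminus
      (fun i hi => by
        split_ifs with h
        · rw [h, sub_self]
        · rw [hi, sub_zero])
      (fun i hi => by
        have : i = i₀ := by simpa using hi
        simp [this])
    refine this.of_forall_eq fun k => ?_
    rw [if_neg (et k).1.2, het, sub_zero]
  refine ⟨t0, tanti, h2.summable, ?_, h1.tsum_eq, fun k => b (et k).1.1, ?_, ?_, ?_⟩
  · rw [tlamTrace, h2.tsum_eq]; ring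
  · exact b.orthonormal.comp _ fun k l hkl => et.injective (Subtype.ext (Subtype.ext hkl))
  · intro k
    have : inner ℝ (b i₀) (b (et k).1.1) = 0 := b.orthonormal.2 (Ne.symm (et k).1.2)
    rwa [h0] at this
  · intro f
    have hm : HasSum (fun i => ν i * (inner ℝ (b i) f) ^ 2 -
        if i = i₀ then ν i₀ * (inner ℝ (b i₀) f) ^ 2 else 0)
        (inner ℝ (kernelOp K hK f) f - ν i₀ * (inner ℝ oneL2 f) ^ 2) := by
      rw [← h0]
      exact (hq f).sub (hasSum_ite_eq i₀ _)
    have := transfer _ _ et t0 het _ _ hm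
      (fun i hi => by
        split_ifs with h
        · rw [h, sub_self]
        · rw [hi, sub_zero, zero_mul])
      (fun i hi => by
        have : i = i₀ := by simpa using hi
        simp [this])
    refine this.of_forall_eq fun k => ?_
    rw [if_neg (et k).1.2, het, sub_zero]
    rfl

/-! ### Random fields as random elements of L₂. -/

/-- Distinct members are at distance √2, so the balls of radius 1/2 around them are disjoint.
Countability is what permits exchanging expectation and Parseval sum. -/
theorem countable_of_orthonormal {H ι : Type*} [NormedAddCommGroup H] [InnerProductSpace ℝ H]
    [TopologicalSpace.SeparableSpace H] {v : ι → H} (hv : Orthonormal ℝ v) : Countable ι := by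
  refine Pairwise.countable_of_isOpen_disjoint (s := fun i => Metric.ball (v i) (1 / 2)) ?_
    (fun i => Metric.isOpen_ball) (fun i => ⟨v i, Metric.mem_ball_self (by norm_num)⟩)
  intro i j hij
  refine Metric.ball_disjoint_ball ?_
  have h : ‖v i - v j‖ ^ 2 = 2 := by
    rw [norm_sub_sq_real, hv.1, hv.1, hv.2 hij]; norm_num
  rw [dist_eq_norm]
  nlinarith [norm_nonneg (v i - v j)]

/-- The scalar product `(Y, g)` in `L₂(T)`. -/
def pairing {Ω T : Type*} [MeasureSpace T] (Y : Ω → T → ℝ) (g : Lp ℝ 2 (volume : Measure T))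
    (ω : Ω) : ℝ := ∫ s, Y ω s * g s

open Classical in
/-- The samples of a random field as elements of `L₂(T)`. -/
def sampleLp {Ω T : Type*} [MeasureSpace T] (Y : Ω → T → ℝ) (ω : Ω) :
    Lp ℝ 2 (volume : Measure T) :=
  if h : MemLp (Y ω) 2 volume then h.toLp else 0

theorem pairing_eq_inner {Ω T : Type*} [MeasureSpace T] {Y : Ω → T → ℝ}
    (g : Lp ℝ 2 (volume : Measure T)) {ω : Ω} (h : MemLp (Y ω) 2 volume) :
    pairing Y g ω = inner ℝ g (sampleLp Y ω) := by
  rw [L2_inner_eq_integral_mul, pairing]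
  refine integral_congr_ae ?_
  rw [sampleLp, dif_pos h]
  filter_upwards [h.coeFn_toLp] with s hs
  rw [hs, mul_comm]

/-- The data of a jointly measurable centered random field with square integrable samples. -/
structure IsL2Field {Ω T : Type*} [MeasurableSpace Ω] [MeasureSpace T] (P : Measure Ω)
    (Y : Ω → T → ℝ) : Prop where
  centered : IsCenteredField P Y
  measurable : Measurable (Function.uncurry Y)
  memLp : MemLp (Function.uncurry Y) 2 (P.prod volume)

/-- Tonelli: integrating the pointwise variance, bounded by C, over a finite measure bounds the
second moment on the product space. -/
theorem IsCenteredField.isL2Field {Ω T : Type*} [MeasurableSpace Ω] [MeasureSpace T]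
    [IsFiniteMeasure (volume : Measure T)] {P : Measure Ω} [IsProbabilityMeasure P]
    {Y : Ω → T → ℝ} (hY : IsCenteredField P Y) (hm : Measurable (Function.uncurry Y)) (C : ℝ)
    (hC : ∀ t, covFunc P Y t t ≤ C) : IsL2Field P Y := by
  refine ⟨hY, hm, ?_⟩
  rw [memLp_two_iff_integrable_sq hm.aestronglyMeasurable,
    integrable_prod_iff' (hm.pow_const 2).aestronglyMeasurable]
  refine ⟨.of_forall fun t => (hY.memLp t).integrable_sq, ?_⟩
  refine Integrable.of_bound (C := C) ?_ (.of_forall fun t => ?_)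
  · have : StronglyMeasurable (Function.uncurry fun t ω => ‖Function.uncurry Y (ω, t) ^ 2‖) :=
      ((hm.comp measurable_swap).pow_const 2).norm.stronglyMeasurable
    exact this.integral_prod_right.aestronglyMeasurable
  · have h1 : ∫ ω, ‖Function.uncurry Y (ω, t) ^ 2‖ ∂P = covFunc P Y t t := by
      rw [covFunc_eq_integral hY]
      refine integral_congr_ae (.of_forall fun ω => ?_)
      simp [sq]
    rw [h1, Real.norm_eq_abs, abs_of_nonneg]
    · exact hC t
    · rw [← h1]; exact integral_nonneg fun ω => norm_nonneg _

namespace IsL2Field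

variable {Ω T : Type*} [MeasurableSpace Ω] [MeasureSpace T] {P : Measure Ω} {Y : Ω → T → ℝ}

theorem integrable_mul_tensor (hY : IsL2Field P Y) (g : Lp ℝ 2 (volume : Measure T)) {Z : Ω → ℝ}
    (hZ : MemLp Z 2 P) :
    Integrable (Function.uncurry fun ω s => Z ω * (Y ω s * g s)) (P.prod volume) := by
  have h1 : MemLp (fun p : Ω × T => Z p.1 * g p.2) 2 (P.prod volume) := by
    have hm : AEStronglyMeasurable (fun p : Ω × T => Z p.1 * g p.2) (P.prod volume) :=
      hZ.1.comp_fst.mul (Lp.aestronglyMeasurable g).comp_snd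
    rw [memLp_two_iff_integrable_sq hm]
    refine (hZ.integrable_sq.mul_prod (Lp.memLp g).integrable_sq).congr (.of_forall fun p => ?_)
    simp only [mul_pow]
  refine (h1.integrable_mul hY.memLp).congr (.of_forall fun p => ?_)
  simp only [Pi.mul_apply, Function.uncurry]
  ring

variable [SigmaFinite (volume : Measure T)]

theorem measurable_pairing (hY : IsL2Field P Y) (g : Lp ℝ 2 (volume : Measure T)) :
    Measurable (pairing Y g) := by
  have : StronglyMeasurable (Function.uncurry fun ω s => Y ω s * g s) :=
    (hY.measurable.mul ((Lp.stronglyMeasurable g).measurable.comp measurable_snd)).stronglyMeasurable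
  exact this.integral_prod_right.measurable

variable [IsProbabilityMeasure P]

theorem ae_memLp (hY : IsL2Field P Y) : ∀ᵐ ω ∂P, MemLp (Y ω) 2 volume := by
  filter_upwards [hY.memLp.integrable_sq.prod_right_ae] with ω hω
  exact (memLp_two_iff_integrable_sq
    (hY.measurable.comp measurable_prodMk_left).aestronglyMeasurable).2 hω

theorem norm_sq_sampleLp {Ω T : Type*} [MeasureSpace T] {Y : Ω → T → ℝ} {ω : Ω}
    (h : MemLp (Y ω) 2 volume) : ‖sampleLp Y ω‖ ^ 2 = ∫ t, Y ω t ^ 2 := by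
  rw [← real_inner_self_eq_norm_sq, L2_inner_eq_integral_mul, sampleLp, dif_pos h]
  refine integral_congr_ae ?_
  filter_upwards [h.coeFn_toLp] with s hs
  rw [hs, sq]

theorem integrable_norm_sq (hY : IsL2Field P Y) : Integrable (fun ω => ‖sampleLp Y ω‖ ^ 2) P := by
  refine hY.memLp.integrable_sq.integral_prod_left.congr ?_
  filter_upwards [hY.ae_memLp] with ω hω
  rw [norm_sq_sampleLp hω]; rfl

theorem integrable_pairing_sq (hY : IsL2Field P Y) (g : Lp ℝ 2 (volume : Measure T)) :
    Integrable (fun ω => pairing Y g ω ^ 2) P := by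
  refine (hY.integrable_norm_sq.const_mul (‖g‖ ^ 2)).mono'
    ((hY.measurable_pairing g).pow_const 2).aestronglyMeasurable ?_
  filter_upwards [hY.ae_memLp] with ω hω
  rw [pairing_eq_inner g hω, Real.norm_eq_abs, abs_of_nonneg (sq_nonneg _), ← mul_pow]
  exact sq_le_sq' (by linarith [neg_abs_le (inner ℝ g (sampleLp Y ω)),
    abs_real_inner_le_norm g (sampleLp Y ω)]) (real_inner_le_norm _ _)

theorem memLp_pairing (hY : IsL2Field P Y) (g : Lp ℝ 2 (volume : Measure T)) :
    MemLp (pairing Y g) 2 P :=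
  (memLp_two_iff_integrable_sq (hY.measurable_pairing g).aestronglyMeasurable).2
    (hY.integrable_pairing_sq g)

/-- Fubini in a form that is used twice for E(Y, g)²: with Z = (Y, g) and then with Z = Y(t). -/
theorem integral_mul_pairing (hY : IsL2Field P Y) (g : Lp ℝ 2 (volume : Measure T)) {Z : Ω → ℝ}
    (hZ : MemLp Z 2 P) :
    ∫ ω, Z ω * pairing Y g ω ∂P = ∫ s, (∫ ω, Z ω * Y ω s ∂P) * g s := by
  simp only [pairing, ← integral_const_mul, ← integral_mul_const]
  rw [integral_integral_swap (hY.integrable_mul_tensor g hZ)]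
  simp only [mul_assoc]

/-- The second moment of `(Y, g)` is the quadratic form of the covariance operator. -/
theorem integral_pairing_sq (hY : IsL2Field P Y) (g : Lp ℝ 2 (volume : Measure T)) :
    ∫ ω, pairing Y g ω ^ 2 ∂P = ∫ t, (∫ s, covFunc P Y t s * g s) * g t := by
  simp only [sq]
  rw [hY.integral_mul_pairing g (hY.memLp_pairing g)]
  congr 1 with t
  congr 1
  have := hY.integral_mul_pairing g (hY.centered.memLp t)
  simp only [← covFunc_eq_integral hY.centered] at this
  rw [← this]
  simp only [mul_comm]

/-- Parseval's identity for the mean square norm of a random field. -/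
theorem hasSum_integral_pairing_sq [TopologicalSpace.SeparableSpace (Lp ℝ 2 (volume : Measure T))]
    (hY : IsL2Field P Y) {ι : Type*} (e : HilbertBasis ι ℝ (Lp ℝ 2 (volume : Measure T))) :
    ENNReal.ofReal (∫ ω, ‖sampleLp Y ω‖ ^ 2 ∂P) =
      ∑' i, ENNReal.ofReal (∫ ω, pairing Y (e i) ω ^ 2 ∂P) := by
  have := countable_of_orthonormal e.orthonormal
  simp_rw [ofReal_integral_eq_lintegral_ofReal (hY.integrable_pairing_sq _)
    (.of_forall fun ω => sq_nonneg _)]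
  rw [ofReal_integral_eq_lintegral_ofReal hY.integrable_norm_sq (.of_forall fun ω => sq_nonneg _),
    ← lintegral_tsum fun i => ((hY.measurable_pairing _).pow_const 2).ennreal_ofReal.aemeasurable]
  refine lintegral_congr_ae ?_
  filter_upwards [hY.ae_memLp] with ω hω
  have h := e.hasSum_inner_mul_inner (sampleLp Y ω) (sampleLp Y ω)
  rw [real_inner_self_eq_norm_sq] at h
  have h' : HasSum (fun i => pairing Y (e i) ω ^ 2) (‖sampleLp Y ω‖ ^ 2) :=
    h.of_forall_eq fun i => by rw [pairing_eq_inner _ hω, real_inner_comm, sq]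
  rw [← h'.tsum_eq, ENNReal.ofReal_tsum_of_nonneg (fun i => sq_nonneg _) h'.summable]

theorem eLpNorm_sub_sq {Ω T : Type*} [MeasureSpace T] {Y : Ω → T → ℝ} {n : ℕ}
    (ψ : Fin n → Lp ℝ 2 (volume : Measure T)) {ω : Ω} (h : MemLp (Y ω) 2 volume) :
    eLpNorm (fun t => Y ω t - ∑ m, (∫ s, Y ω s * ψ m s) * ψ m t) 2 volume ^ 2 =
      ENNReal.ofReal
        (‖sampleLp Y ω - ∑ m, inner ℝ (ψ m) (sampleLp Y ω) • ψ m‖ ^ 2) := by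
  have h1 : (fun t => Y ω t - ∑ m, (∫ s, Y ω s * ψ m s) * ψ m t) =ᵐ[volume]
      (sampleLp Y ω - ∑ m, inner ℝ (ψ m) (sampleLp Y ω) • ψ m : Lp ℝ 2 (volume : Measure T)) := by
    have h2 : ∀ᵐ t, ∀ m, ((inner ℝ (ψ m) (sampleLp Y ω) • ψ m :
        Lp ℝ 2 (volume : Measure T)) : T → ℝ) t = pairing Y (ψ m) ω * ψ m t := by
      rw [ae_all_iff]
      intro m
      filter_upwards [Lp.coeFn_smul (inner ℝ (ψ m) (sampleLp Y ω)) (ψ m)] with t ht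
      rw [ht, pairing_eq_inner _ h]; rfl
    filter_upwards [h2, Lp.coeFn_sub (sampleLp Y ω) (∑ m, inner ℝ (ψ m) (sampleLp Y ω) • ψ m),
      Lp.coeFn_finsetSum Finset.univ (fun m => inner ℝ (ψ m) (sampleLp Y ω) • ψ m),
      h.coeFn_toLp] with t h2 h3 h4 h5
    rw [h3, Pi.sub_apply, h4, Finset.sum_apply]
    simp only [h2]
    rw [sampleLp, dif_pos h, h5]
    rfl
  rw [eLpNorm_congr_ae h1, ← Lp.enorm_def, ← ofReal_norm,
    ENNReal.ofReal_pow (norm_nonneg _)]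

end IsL2Field

/-! ### Approximation error, and primal and dual bounds for the complexity. -/

section Hilbert

variable {H : Type*} [NormedAddCommGroup H] [InnerProductSpace ℝ H]

/-- The distance to a point of the span of `n` vectors is at least the distance to the span. -/
theorem exists_orthonormal_le_norm_sub_sq {n : ℕ} (ψ : Fin n → H) :
    ∃ r ≤ n, ∃ e : Fin r → H, Orthonormal ℝ e ∧ ∀ y, ∀ x ∈ Submodule.span ℝ (Set.range ψ),
      ‖y‖ ^ 2 - ∑ l, inner ℝ (e l) y ^ 2 ≤ ‖y - x‖ ^ 2 := by
  let V := Submodule.span ℝ (Set.range ψ)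
  have : FiniteDimensional ℝ V := FiniteDimensional.span_of_finite ℝ (Set.finite_range ψ)
  let e := stdOrthonormalBasis ℝ V
  refine ⟨Module.finrank ℝ V, ?_, fun l => (e l : H), ?_, fun y x hx => ?_⟩
  · exact (finrank_range_le_card ψ).trans_eq (Fintype.card_fin n)
  · exact e.orthonormal.comp_linearIsometry V.subtypeₗᵢ
  · have h1 : ∑ l, inner ℝ (e l : H) y ^ 2 = ‖V.orthogonalProjectionOnto y‖ ^ 2 := by
      rw [← e.sum_sq_norm_inner_right]
      refine Finset.sum_congr rfl fun l _ => ?_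
      rw [Real.norm_eq_abs, sq_abs, Submodule.inner_orthogonalProjectionOnto_eq_of_mem_left]
    have h2 := V.norm_sq_eq_add_norm_sq_projection y
    have h3 : ‖Vᗮ.orthogonalProjectionOnto y‖ ≤ ‖y - x‖ := by
      have : (Vᗮ.orthogonalProjectionOnto y) = Vᗮ.orthogonalProjectionOnto (y - x) := by
        rw [map_sub, Submodule.orthogonalProjectionOnto_orthogonal_apply_eq_zero hx, sub_zero]
      rw [this]
      exact Submodule.norm_orthogonalProjectionOnto_apply_le _ _
    rw [h1, h2]
    nlinarith [norm_nonneg (Vᗮ.orthogonalProjectionOnto y)]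

theorem norm_sub_sum_inner_smul_sq {n : ℕ} {e : Fin n → H} (he : Orthonormal ℝ e) (y : H) :
    ‖y - ∑ l, inner ℝ (e l) y • e l‖ ^ 2 = ‖y‖ ^ 2 - ∑ l, inner ℝ (e l) y ^ 2 := by
  rw [norm_sub_sq_real, ← real_inner_self_eq_norm_sq (∑ l, inner ℝ (e l) y • e l),
    he.inner_sum, inner_sum]
  simp only [inner_smul_right, real_inner_comm y, RCLike.conj_to_real, ← sq]
  ring

/-- The variational bound for the sum of a quadratic form over an orthonormal family. -/
theorem sum_quadratic_le {α : Type*} {w : α → H} (hw : Orthonormal ℝ w) {ν : α → ℝ}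
    (hν : ∀ a, 0 ≤ ν a) (hsum : Summable ν) (q : H → ℝ)
    (hq : ∀ g, HasSum (fun a => ν a * inner ℝ (w a) g ^ 2) (q g)) {r n : ℕ} (hrn : r ≤ n)
    {e : Fin r → H} (he : Orthonormal ℝ e) {τ : ℝ} (hτ : 0 < τ) :
    ∑ l, q (e l) ≤ ∑' a, max (ν a - τ) 0 + τ * n := by
  -- The weights c_a = ∑ ⟨w a, e l⟩² satisfy c_a ≤ 1 by Bessel for e and ∑ c_a ≤ r by Bessel for w;
  -- then ν c ≤ (ν − τ)⁺ + τ c is summed over a.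
  have h1 : HasSum (fun a => ν a * ∑ l, inner ℝ (w a) (e l) ^ 2) (∑ l, q (e l)) := by
    simp only [Finset.mul_sum]
    exact hasSum_sum fun l _ => hq (e l)
  have h2 : ∀ l, Summable fun a => inner ℝ (w a) (e l) ^ 2 := fun l => by
    have := hw.inner_products_summable (e l)
    simpa using this
  have h3 : ∀ l, ∑' a, inner ℝ (w a) (e l) ^ 2 ≤ 1 := fun l => by
    have := hw.tsum_inner_products_le (e l)
    simpa [he.1] using this
  have h4 : ∀ a, ∑ l, inner ℝ (w a) (e l) ^ 2 ≤ 1 := fun a => by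
    have := he.sum_inner_products_le (w a) (s := Finset.univ)
    simpa [hw.1, real_inner_comm] using this
  have h5 : Summable fun a => ∑ l, inner ℝ (w a) (e l) ^ 2 := summable_sum fun l _ => h2 l
  have h6 : Summable fun a => max (ν a - τ) 0 :=
    hsum.of_nonneg_of_le (fun a => le_max_right _ _)
      fun a => max_le (by linarith) (hν a)
  rw [← h1.tsum_eq]
  calc ∑' a, ν a * ∑ l, inner ℝ (w a) (e l) ^ 2
      ≤ ∑' a, (max (ν a - τ) 0 + τ * ∑ l, inner ℝ (w a) (e l) ^ 2) := by
        refine h1.summable.tsum_le_tsum (fun a => ?_) (h6.add (h5.mul_left τ))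
        have hc0 : 0 ≤ ∑ l, inner ℝ (w a) (e l) ^ 2 := Finset.sum_nonneg fun _ _ => sq_nonneg _
        have := h4 a
        rcases le_total (ν a - τ) 0 with h | h
        · rw [max_eq_right h]; nlinarith
        · rw [max_eq_left h]; nlinarith
    _ = ∑' a, max (ν a - τ) 0 + τ * ∑' a, ∑ l, inner ℝ (w a) (e l) ^ 2 := by
        rw [h6.tsum_add (h5.mul_left τ), tsum_mul_left]
    _ ≤ _ := by
        gcongr
        rw [Summable.tsum_finsetSum fun l _ => h2 l]
        refine (Finset.sum_le_sum fun l _ => h3 l).trans ?_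
        simpa using hrn

end Hilbert

namespace IsL2Field

variable {Ω T : Type*} [MeasurableSpace Ω] [MeasureSpace T] [SigmaFinite (volume : Measure T)]
  {P : Measure Ω} [IsProbabilityMeasure P] {Y : Ω → T → ℝ}

theorem lintegral_eLpNorm_sub_sq (hY : IsL2Field P Y) {n : ℕ}
    {e : Fin n → Lp ℝ 2 (volume : Measure T)} (he : Orthonormal ℝ e) :
    ∫⁻ ω, eLpNorm (fun t => Y ω t - ∑ m, (∫ s, Y ω s * e m s) * e m t) 2 volume ^ 2 ∂P =
      ENNReal.ofReal (∫ ω, ‖sampleLp Y ω‖ ^ 2 ∂P - ∑ m, ∫ ω, pairing Y (e m) ω ^ 2 ∂P) := by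
  have hs : Integrable (fun ω => ∑ m, pairing Y (e m) ω ^ 2) P :=
    integrable_finsetSum _ fun m _ => hY.integrable_pairing_sq (e m)
  have hi : Integrable (fun ω => ‖sampleLp Y ω‖ ^ 2 - ∑ m, pairing Y (e m) ω ^ 2) P :=
    hY.integrable_norm_sq.sub hs
  rw [← integral_finsetSum _ fun m _ => hY.integrable_pairing_sq (e m),
    ← integral_sub hY.integrable_norm_sq hs, ofReal_integral_eq_lintegral_ofReal hi]
  · refine lintegral_congr_ae ?_
    filter_upwards [hY.ae_memLp] with ω hω
    rw [eLpNorm_sub_sq e hω, norm_sub_sum_inner_smul_sq he]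
    simp only [pairing_eq_inner _ hω]
  · filter_upwards [hY.ae_memLp] with ω hω
    simp only [pairing_eq_inner _ hω, Pi.zero_apply]
    rw [← norm_sub_sum_inner_smul_sq he]
    positivity

theorem minAvgError_le (hY : IsL2Field P Y) {n : ℕ}
    {e : Fin n → Lp ℝ 2 (volume : Measure T)} (he : Orthonormal ℝ e) :
    minAvgError P Y n ≤ ENNReal.ofReal
      (∫ ω, ‖sampleLp Y ω‖ ^ 2 ∂P - ∑ m, ∫ ω, pairing Y (e m) ω ^ 2 ∂P) ^ (1 / 2 : ℝ) := by
  rw [← hY.lintegral_eLpNorm_sub_sq he]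
  exact iInf_le _ e

theorem minAvgError_zero (hY : IsL2Field P Y) :
    minAvgError P Y 0 = ENNReal.ofReal (∫ ω, ‖sampleLp Y ω‖ ^ 2 ∂P) ^ (1 / 2 : ℝ) := by
  have h : ∀ e : Fin 0 → Lp ℝ 2 (volume : Measure T), Orthonormal ℝ e := fun e =>
    ⟨fun i => i.elim0, fun i => i.elim0⟩
  rw [minAvgError]
  simp_rw [hY.lintegral_eLpNorm_sub_sq (h _)]
  simp

/-- The ψ's of the definition are arbitrary, but every approximant lies in their span, so an
orthonormal basis of the span does at least as well; its size r may be less than n. -/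
theorem le_minAvgError (hY : IsL2Field P Y) {n : ℕ} {B : ℝ}
    (hB : ∀ r ≤ n, ∀ e : Fin r → Lp ℝ 2 (volume : Measure T), Orthonormal ℝ e →
      B ≤ ∫ ω, ‖sampleLp Y ω‖ ^ 2 ∂P - ∑ m, ∫ ω, pairing Y (e m) ω ^ 2 ∂P) :
    ENNReal.ofReal B ^ (1 / 2 : ℝ) ≤ minAvgError P Y n := by
  refine le_iInf fun ψ => ENNReal.rpow_le_rpow ?_ (by norm_num)
  obtain ⟨r, hr, e, he, h⟩ := exists_orthonormal_le_norm_sub_sq ψ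
  refine (ENNReal.ofReal_le_ofReal (hB r hr e he)).trans ?_
  rw [← hY.lintegral_eLpNorm_sub_sq he]
  refine lintegral_mono_ae ?_
  filter_upwards [hY.ae_memLp] with ω hω
  rw [eLpNorm_sub_sq e hω, eLpNorm_sub_sq ψ hω, norm_sub_sum_inner_smul_sq he]
  refine ENNReal.ofReal_le_ofReal (h _ _ (Submodule.sum_mem _ fun m _ =>
    Submodule.smul_mem _ _ (Submodule.subset_span ⟨m, rfl⟩)))

theorem ofReal_mul_rpow_half {ε D : ℝ} (hε : 0 ≤ ε) :
    ENNReal.ofReal ε * ENNReal.ofReal D ^ (1 / 2 : ℝ) =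
      ENNReal.ofReal (ε ^ 2 * D) ^ (1 / 2 : ℝ) := by
  rw [ENNReal.ofReal_mul (sq_nonneg ε), ENNReal.mul_rpow_of_nonneg _ _ (by norm_num),
    ENNReal.ofReal_pow hε, ← ENNReal.rpow_natCast, ← ENNReal.rpow_mul]
  norm_num

/-- Upper and lower bounds for the approximation complexity of a random field whose covariance
operator is diagonal in a known orthonormal family. -/
theorem approxComplexity_bounds (hY : IsL2Field P Y) {α : Type*} [Nonempty α]
    {w : α → Lp ℝ 2 (volume : Measure T)} (hw : Orthonormal ℝ w) {ν : α → ℝ} (hν : ∀ a, 0 ≤ ν a)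
    (hD : HasSum ν (∫ ω, ‖sampleLp Y ω‖ ^ 2 ∂P))
    (hq : ∀ g, HasSum (fun a => ν a * inner ℝ (w a) g ^ 2) (∫ ω, pairing Y g ω ^ 2 ∂P))
    {ε : ℝ} (hε : 0 < ε) :
    (∀ F : Finset α, F.Nonempty → (1 - ε ^ 2) * ∑' a, ν a ≤ ∑ a ∈ F, ν a →
      approxComplexity P Y ε ≤ F.card) ∧
    ∀ τ, 0 < τ → (1 - ε ^ 2) * ∑' a, ν a ≤
      ∑' a, max (ν a - τ) 0 + τ * approxComplexity P Y ε := by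
  classical
  have hqw : ∀ a, ∫ ω, pairing Y (w a) ω ^ 2 ∂P = ν a := by
    intro a
    refine (hq (w a)).unique ?_
    have := hasSum_ite_eq a (ν a)
    refine this.of_forall_eq fun c => ?_
    rw [orthonormal_iff_ite.1 hw]
    split_ifs with h <;> simp [h]
  have hset : ∀ F : Finset α, F.Nonempty → (1 - ε ^ 2) * ∑' a, ν a ≤ ∑ a ∈ F, ν a →
      F.card ∈ {n : ℕ | 1 ≤ n ∧ minAvgError P Y n ≤ ENNReal.ofReal ε * minAvgError P Y 0} := by
    intro F hF hsum
    refine ⟨hF.card_pos, ?_⟩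
    have he : Orthonormal ℝ (fun m : Fin F.card => w (F.equivFin.symm m)) :=
      hw.comp _ (Subtype.val_injective.comp F.equivFin.symm.injective)
    refine (hY.minAvgError_le he).trans ?_
    rw [hY.minAvgError_zero, ofReal_mul_rpow_half hε.le]
    refine ENNReal.rpow_le_rpow (ENNReal.ofReal_le_ofReal ?_) (by norm_num)
    simp only [hqw]
    rw [Equiv.sum_comp F.equivFin.symm (fun a : F => ν a), Finset.sum_coe_sort F ν]
    rw [hD.tsum_eq] at hsum
    linarith
  refine ⟨fun F hF hsum => Nat.sInf_le (hset F hF hsum), fun τ hτ => ?_⟩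
  -- Without an admissible n the infimum would be the default 0 and carry no information. If the
  -- trace is zero any singleton works; otherwise a large partial sum exceeds the share 1 − ε² of
  -- the trace.
  have hne : {n : ℕ | 1 ≤ n ∧ minAvgError P Y n ≤
      ENNReal.ofReal ε * minAvgError P Y 0}.Nonempty := by
    obtain ⟨a₀⟩ := ‹Nonempty α›
    rcases (tsum_nonneg hν).eq_or_lt with h0 | h0
    · exact ⟨_, hset {a₀} (Finset.singleton_nonempty _) (by
        rw [← h0, mul_zero]; exact Finset.sum_nonneg fun a _ => hν a)⟩
    · have hlt : (1 - ε ^ 2) * ∑' a, ν a < ∑' a, ν a := by nlinarith [sq_pos_of_pos hε]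
      have := (hD.summable.hasSum.eventually (lt_mem_nhds hlt)).and
        (eventually_ge_atTop {a₀})
      obtain ⟨F, hF, hF0⟩ := this.exists
      exact ⟨_, hset F ⟨a₀, hF0 (Finset.mem_singleton_self _)⟩ hF.le⟩
  have hmem : minAvgError P Y (approxComplexity P Y ε) ≤
      ENNReal.ofReal ε * minAvgError P Y 0 := (Nat.sInf_mem hne).2
  rw [hY.minAvgError_zero, ofReal_mul_rpow_half hε.le] at hmem
  set N := approxComplexity P Y ε with hN
  -- B is the trace minus the variational bound on the mass captured by at most N orthonormal
  -- functions.
  have hlow := (hY.le_minAvgError (n := N)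
    (B := ∑' a, ν a - (∑' a, max (ν a - τ) 0 + τ * N)) fun r hr e he => ?_).trans hmem
  · rw [ENNReal.rpow_le_rpow_iff (by norm_num), ENNReal.ofReal_le_ofReal_iff, ← hD.tsum_eq] at hlow
    · linarith
    · rw [← hD.tsum_eq]
      exact mul_nonneg (sq_nonneg _) (tsum_nonneg hν)
  · have := sum_quadratic_le hw hν hD.summable _ hq hr he hτ
    rw [hD.tsum_eq]
    linarith

end IsL2Field

/-! ### Additive fields on the cube and their spectrum. -/

/-- Functions of the `j`-th coordinate as elements of `L₂([0,1]^d)`. -/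
def coordEmb {d : ℕ} (j : Fin d) :
    Lp ℝ 2 (volume : Measure I) →ₗᵢ[ℝ] Lp ℝ 2 (volume : Measure (Fin d → I)) :=
  Lp.compMeasurePreservingₗᵢ ℝ (Function.eval j) (measurePreserving_eval _ j)

theorem coeFn_coordEmb {d : ℕ} (j : Fin d) (f : Lp ℝ 2 (volume : Measure I)) :
    coordEmb j f =ᵐ[volume] fun t => f (t j) :=
  Lp.coeFn_compMeasurePreserving f (measurePreserving_eval _ j)

/-- The adjoint of `coordEmb`, which integrates out all the coordinates but one. -/
def coordProj {d : ℕ} (j : Fin d) :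
    Lp ℝ 2 (volume : Measure (Fin d → I)) →L[ℝ] Lp ℝ 2 (volume : Measure I) :=
  ContinuousLinearMap.adjoint (coordEmb j).toContinuousLinearMap

theorem inner_coordProj {d : ℕ} (j : Fin d) (f : Lp ℝ 2 (volume : Measure I))
    (g : Lp ℝ 2 (volume : Measure (Fin d → I))) :
    inner ℝ f (coordProj j g) = inner ℝ (coordEmb j f) g :=
  ContinuousLinearMap.adjoint_inner_right _ _ _

/-- The function identically equal to `1` in `L₂([0,1]^d)`. -/
def oneCube (d : ℕ) : Lp ℝ 2 (volume : Measure (Fin d → I)) := Lp.const 2 volume 1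

theorem norm_oneCube (d : ℕ) : ‖oneCube d‖ = 1 := by
  rw [oneCube, Lp.norm_const] <;> simp

theorem coordEmb_oneL2 {d : ℕ} (j : Fin d) : coordEmb j oneL2 = oneCube d := by
  refine Lp.ext ?_
  have h := (measurePreserving_eval (fun _ : Fin d => (volume : Measure I)) j).quasiMeasurePreserving.ae
    coeFn_oneL2
  filter_upwards [coeFn_coordEmb j oneL2, Lp.coeFn_const 2 (volume : Measure (Fin d → I)) (1 : ℝ),
    h] with t h1 h2 h3
  rw [h1, oneCube, h2]
  exact h3

theorem inner_oneL2 (f : Lp ℝ 2 (volume : Measure I)) : inner ℝ oneL2 f = ∫ t, f t := by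
  rw [L2_inner_eq_integral_mul]
  refine integral_congr_ae ?_
  filter_upwards [coeFn_oneL2] with t ht
  rw [ht, one_mul]

/-- Distinct coordinates are independent under the product measure. Consequently, orthogonality to 1
in one marginal makes functions of different coordinates orthogonal. -/
theorem inner_coordEmb_of_ne {d : ℕ} {i j : Fin d} (hij : i ≠ j)
    (f g : Lp ℝ 2 (volume : Measure I)) :
    inner ℝ (coordEmb i f) (coordEmb j g) = inner ℝ oneL2 f * inner ℝ oneL2 g := by
  rw [L2_inner_eq_integral_mul, inner_oneL2, inner_oneL2]
  have h1 : ∫ t, coordEmb i f t * coordEmb j g t = ∫ t : Fin d → I, ∏ l,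
      (if l = i then (f : I → ℝ) else if l = j then (g : I → ℝ) else fun _ => 1) (t l) := by
    refine integral_congr_ae ?_
    filter_upwards [coeFn_coordEmb i f, coeFn_coordEmb j g] with t h1 h2
    rw [h1, h2, ← Finset.mul_prod_erase _ _ (Finset.mem_univ i),
      ← Finset.mul_prod_erase _ _ (Finset.mem_erase.2 ⟨hij.symm, Finset.mem_univ j⟩),
      Finset.prod_eq_one]
    · simp [hij.symm]
    · intro l hl
      simp only [Finset.mem_erase] at hl
      simp [hl.1, hl.2.1]
  rw [h1, integral_fintype_prod_volume_eq_prod (fun l : Fin d =>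
      (if l = i then (f : I → ℝ) else if l = j then (g : I → ℝ) else fun _ => 1)),
    ← Finset.mul_prod_erase _ _ (Finset.mem_univ i),
    ← Finset.mul_prod_erase _ _ (Finset.mem_erase.2 ⟨hij.symm, Finset.mem_univ j⟩),
    Finset.prod_eq_one]
  · simp [hij.symm]
  · intro l hl
    simp only [Finset.mem_erase] at hl
    simp [hl.1, hl.2.1]

theorem integrable_mul_Lp_two {T : Type*} [MeasureSpace T] (f g : Lp ℝ 2 (volume : Measure T)) :
    Integrable (fun t => f t * g t) := (Lp.memLp f).integrable_mul (Lp.memLp g)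

/-- The quadratic form of an additive kernel on the cube. -/
theorem integral_additive_kernel {d : ℕ} (K : ℕ → I → I → ℝ)
    (hK : ∀ j, Continuous (Function.uncurry (K j))) (g : Lp ℝ 2 (volume : Measure (Fin d → I))) :
    ∫ t, (∫ s, (∑ j : Fin d, K j (t j) (s j)) * g s) * g t =
      ∑ j : Fin d, inner ℝ (kernelOp (K j) (hK j) (coordProj j g)) (coordProj j g) := by
  have hker : ∀ (j : Fin d) (x : I),
      (fun s : Fin d → I => K j x (s j) * g s) =ᵐ[volume]
        fun s => coordEmb j (kernelSection (K j) (hK j) x) s * g s := by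
    intro j x
    have h := (measurePreserving_eval (fun _ : Fin d => (volume : Measure I))
      j).quasiMeasurePreserving.ae (coeFn_kernelSection (K j) (hK j) x)
    filter_upwards [h, coeFn_coordEmb j (kernelSection (K j) (hK j) x)] with s h1 h2
    rw [h2]
    exact congrArg (· * g s) h1.symm
  have h1 : ∀ t : Fin d → I, ∫ s, (∑ j : Fin d, K j (t j) (s j)) * g s =
      ∑ j : Fin d, inner ℝ (kernelSection (K j) (hK j) (t j)) (coordProj j g) := by
    intro t
    simp only [Finset.sum_mul]
    rw [integral_finsetSum _ fun j _ =>
      (integrable_mul_Lp_two _ _).congr (hker j (t j)).symm]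
    refine Finset.sum_congr rfl fun j _ => ?_
    rw [inner_coordProj, L2_inner_eq_integral_mul]
    exact integral_congr_ae (hker j (t j))
  have h2 : ∀ j : Fin d,
      (fun t : Fin d → I => inner ℝ (kernelSection (K j) (hK j) (t j)) (coordProj j g) * g t)
        =ᵐ[volume] fun t => coordEmb j (kernelOp (K j) (hK j) (coordProj j g)) t * g t := by
    intro j
    have h := (measurePreserving_eval (fun _ : Fin d => (volume : Measure I))
      j).quasiMeasurePreserving.ae (coeFn_kernelOp (K j) (hK j) (coordProj j g))
    filter_upwards [h, coeFn_coordEmb j (kernelOp (K j) (hK j) (coordProj j g))] with t h1 h2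
    rw [h2]
    exact congrArg (· * g t) h1.symm
  simp only [h1]
  simp only [Finset.sum_mul]
  rw [integral_finsetSum _ fun j _ => (integrable_mul_Lp_two _ _).congr (h2 j).symm]
  refine Finset.sum_congr rfl fun j _ => ?_
  rw [inner_coordProj, L2_inner_eq_integral_mul]
  exact integral_congr_ae (h2 j)

theorem isL2Field_additive {d : ℕ} {Ω : Type*} [MeasurableSpace Ω] (P : Measure Ω)
    [IsProbabilityMeasure P] (Y : Ω → (Fin d → I) → ℝ) (hY : IsCenteredField P Y)
    (hYm : Measurable (Function.uncurry Y)) (K : ℕ → I → I → ℝ)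
    (hK : ∀ j, Continuous (Function.uncurry (K j)))
    (hcov : ∀ t s, covFunc P Y t s = ∑ j : Fin d, K j (t j) (s j)) : IsL2Field P Y := by
  have h : ∀ j, ∃ C, ∀ x, K j x x ≤ C := by
    intro j
    have hc : Continuous fun x => K j x x := (hK j).comp (continuous_id.prodMk continuous_id)
    obtain ⟨C, hC⟩ := (isCompact_range hc).bddAbove
    exact ⟨C, fun x => hC ⟨x, rfl⟩⟩
  choose C hC using h
  refine hY.isL2Field hYm (∑ j : Fin d, C j) fun t => ?_
  rw [hcov]
  exact Finset.sum_le_sum fun j _ => hC j (t j)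

theorem separableSpace_Lp_cube (d : ℕ) :
    TopologicalSpace.SeparableSpace (Lp ℝ 2 (volume : Measure (Fin d → I))) := by
  have : Fact ((2 : ENNReal) ≠ ⊤) := ⟨by norm_num⟩
  have : @MeasurableSpace.CountablyGenerated (Fin d → I) MeasureSpace.toMeasurableSpace :=
    inferInstanceAs (@MeasurableSpace.CountablyGenerated (Fin d → I) MeasurableSpace.pi)
  infer_instance

/-- The trace identity: the mean square norm of an additive field is the sum of all the marginal
eigenvalues. -/
theorem additive_trace {d : ℕ} {Ω : Type*} [MeasurableSpace Ω] (P : Measure Ω)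
    [IsProbabilityMeasure P] (Y : Ω → (Fin d → I) → ℝ) (hY : IsL2Field P Y) (K : ℕ → I → I → ℝ)
    (hK : ∀ j, Continuous (Function.uncurry (K j)))
    (hcov : ∀ t s, covFunc P Y t s = ∑ j : Fin d, K j (t j) (s j))
    {ι : ℕ → Type} (b : ∀ j, HilbertBasis (ι j) ℝ (Lp ℝ 2 (volume : Measure I)))
    (ν : ∀ j, ι j → ℝ) (hν : ∀ j i, 0 ≤ ν j i)
    (hq : ∀ j f, HasSum (fun i => ν j i * (inner ℝ (b j i) f) ^ 2)
      (inner ℝ (kernelOp (K j) (hK j) f) f)) :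
    (∀ j : Fin d, Summable (ν j)) ∧
      ∫ ω, ‖sampleLp Y ω‖ ^ 2 ∂P = ∑ j : Fin d, ∑' i, ν j i := by
  have := separableSpace_Lp_cube d
  obtain ⟨S, e, -⟩ := exists_hilbertBasis ℝ (Lp ℝ 2 (volume : Measure (Fin d → I)))
  -- Parseval in the basis e of L₂ of the cube for the unit vector `coordEmb j (b j i)`.
  have hunit : ∀ (j : Fin d) i,
      ∑' l, ENNReal.ofReal ((inner ℝ (b j i) (coordProj j (e l))) ^ 2) = 1 := by
    intro j i
    have h := e.hasSum_inner_mul_inner (coordEmb j (b j i)) (coordEmb j (b j i))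
    rw [real_inner_self_eq_norm_sq, LinearIsometry.norm_map, (b j).orthonormal.1, one_pow] at h
    have h' : HasSum (fun l => (inner ℝ (b j i) (coordProj j (e l))) ^ 2) 1 :=
      h.of_forall_eq fun l => by
        rw [inner_coordProj, real_inner_comm (coordEmb j (b j i)) (e l), sq]
    rw [← ENNReal.ofReal_tsum_of_nonneg (fun l => sq_nonneg _) h'.summable, h'.tsum_eq,
      ENNReal.ofReal_one]
  -- Extended nonnegative sums can be interchanged freely. As the left side is finite, the marginal
  -- eigenvalues turn out to be summable, so no Mercer theorem is needed.
  have key : ENNReal.ofReal (∫ ω, ‖sampleLp Y ω‖ ^ 2 ∂P) =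
      ∑ j : Fin d, ∑' i, ENNReal.ofReal (ν j i) := by
    rw [hY.hasSum_integral_pairing_sq e]
    have h1 : ∀ l, ENNReal.ofReal (∫ ω, pairing Y (e l) ω ^ 2 ∂P) = ∑ j : Fin d, ∑' i,
        ENNReal.ofReal (ν j i) * ENNReal.ofReal ((inner ℝ (b j i) (coordProj j (e l))) ^ 2) := by
      intro l
      rw [hY.integral_pairing_sq]
      simp only [hcov]
      rw [integral_additive_kernel K hK, ENNReal.ofReal_sum_of_nonneg fun (j : Fin d) _ =>
        (hq j (coordProj j (e l))).nonneg fun i => mul_nonneg (hν _ _) (sq_nonneg _)]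
      refine Finset.sum_congr rfl fun j _ => ?_
      rw [← (hq j (coordProj j (e l))).tsum_eq, ENNReal.ofReal_tsum_of_nonneg
        (fun i => mul_nonneg (hν _ _) (sq_nonneg _)) (hq j (coordProj j (e l))).summable]
      simp only [ENNReal.ofReal_mul (hν _ _)]
    simp only [h1]
    rw [Summable.tsum_finsetSum fun j _ => ENNReal.summable]
    refine Finset.sum_congr rfl fun j _ => ?_
    rw [ENNReal.tsum_comm]
    simp only [ENNReal.tsum_mul_left, hunit, mul_one]
  have hs : ∀ j : Fin d, Summable (ν j) := by
    intro j
    have hne : ∑' i, ENNReal.ofReal (ν j i) ≠ ⊤ := by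
      intro htop
      have : ∑ j : Fin d, ∑' i, ENNReal.ofReal (ν j i) = ⊤ :=
        ENNReal.sum_eq_top.2 ⟨j, Finset.mem_univ _, htop⟩
      rw [← key] at this
      exact ENNReal.ofReal_ne_top this
    have := ENNReal.summable_toReal hne
    simpa only [ENNReal.toReal_ofReal (hν j _)] using this
  refine ⟨hs, ?_⟩
  have h2 : ∑ j : Fin d, ∑' i, ENNReal.ofReal (ν j i) =
      ENNReal.ofReal (∑ j : Fin d, ∑' i, ν j i) := by
    rw [ENNReal.ofReal_sum_of_nonneg (f := fun j : Fin d => ∑' i, ν j i)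
      fun j _ => tsum_nonneg (hν j)]
    exact Finset.sum_congr rfl fun j _ => (ENNReal.ofReal_tsum_of_nonneg (hν j) (hs j)).symm
  rw [h2, ENNReal.ofReal_eq_ofReal_iff (integral_nonneg fun ω => by positivity)
    (Finset.sum_nonneg fun (j : Fin d) _ => tsum_nonneg (hν j))] at key
  exact key

/-- The orthonormal family of the function `1` and of the marginal eigenfunctions orthogonal to it,
as functions on the cube. -/
def additiveFamily {d : ℕ} {β : ℕ → Type} (v : ∀ j, β j → Lp ℝ 2 (volume : Measure I)) :
    Unit ⊕ (Σ j : Fin d, β j) → Lp ℝ 2 (volume : Measure (Fin d → I)) :=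
  Sum.elim (fun _ => oneCube d) fun p => coordEmb p.1 (v p.1 p.2)

theorem orthonormal_additiveFamily {d : ℕ} {β : ℕ → Type}
    (v : ∀ j, β j → Lp ℝ 2 (volume : Measure I)) (hv : ∀ j, Orthonormal ℝ (v j))
    (hv1 : ∀ j k, inner ℝ oneL2 (v j k) = 0) :
    Orthonormal ℝ (additiveFamily (d := d) v) := by
  have h1 : ∀ (j : Fin d) k, inner ℝ (oneCube d) (coordEmb j (v j k)) = 0 := fun j k => by
    rw [← coordEmb_oneL2 j, LinearIsometry.inner_map_map, hv1]
  refine ⟨?_, ?_⟩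
  · rintro (_ | ⟨j, k⟩)
    · exact norm_oneCube d
    · exact ((coordEmb j).norm_map _).trans ((hv j).1 k)
  · rintro (_ | ⟨j, k⟩) (_ | ⟨j', k'⟩) hne
    · exact absurd rfl hne
    · exact h1 j' k'
    · exact (real_inner_comm _ _).trans (h1 j k)
    · show inner ℝ (coordEmb j (v j k)) (coordEmb j' (v j' k')) = 0
      rcases eq_or_ne j j' with rfl | hjj
      · rw [LinearIsometry.inner_map_map]
        exact (hv j).2 fun h => hne (by rw [h])
      · rw [inner_coordEmb_of_ne hjj, hv1, zero_mul]

theorem hasSum_unit_sum_sigma {d : ℕ} {β : ℕ → Type} (c : ℝ) (F : ∀ j, β j → ℝ)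
    (hF : ∀ j k, 0 ≤ F j k) (s : ℕ → ℝ) (hs : ∀ j, HasSum (F j) (s j)) :
    HasSum (Sum.elim (fun _ => c) fun p => F p.1 p.2 : Unit ⊕ (Σ j : Fin d, β j) → ℝ)
      (c + ∑ j : Fin d, s j) := by
  refine HasSum.sum (hasSum_unique _) ?_
  have hsm : Summable fun p : Σ j : Fin d, β j => F p.1 p.2 :=
    (summable_sigma_of_nonneg fun p => hF _ _).2
      ⟨fun j => (hs j).summable, (hasSum_fintype _).summable⟩
  exact HasSum.sigma_of_hasSum (hasSum_fintype _) (fun j => hs j) hsm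

/-- Each marginal adds its eigenvalue of 1 to the common constant function and keeps the others, so
the eigenvalues on the cube are explicit. In the resulting bounds the constant is split off: one
extra function pays for it from above, and from below it captures at most its whole eigenvalue. -/
theorem additive_eigenvalue_bounds
    {Ω' : ℕ → Type*} [∀ j, MeasurableSpace (Ω' j)] (P' : ∀ j, Measure (Ω' j))
    (X : ∀ j, Ω' j → I → ℝ)
    (hX : ∀ j, IsCenteredField (P' j) (X j))
    (K : ℕ → I → I → ℝ) (hK : ∀ j, K j = covFunc (P' j) (X j))
    (hKcont : ∀ j, Continuous (Function.uncurry (K j)))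
    {Ω : ℕ → Type*} [∀ d, MeasurableSpace (Ω d)] (P : ∀ d, Measure (Ω d))
    [∀ d, IsProbabilityMeasure (P d)] (Y : ∀ d, Ω d → (Fin d → I) → ℝ)
    (hY : ∀ d, IsCenteredField (P d) (Y d))
    (hYmeas : ∀ d, Measurable (Function.uncurry (Y d)))
    (hYcov : ∀ d t s, covFunc (P d) (Y d) t s = ∑ j : Fin d, K j (t j) (s j))
    (lam0 : ℕ → ℝ) (hlam0 : ∀ j, IsEigenfunction (K j) (lam0 j) oneL2) :
    (∀ j, 0 ≤ lam0 j ∧ (∀ k, 0 ≤ tlamSeq (K j) k) ∧ Antitone (tlamSeq (K j)) ∧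
      Summable (tlamSeq (K j)) ∧ lamTrace (K j) = lam0 j + tlamTrace (K j)) ∧
    ∀ d ε, 0 < ε →
      (∀ F : Finset (Fin d × ℕ), (∀ p ∈ F, 0 < tlamSeq (K p.1) p.2) →
        (1 - ε ^ 2) * ∑ j ∈ Finset.range d, lamTrace (K j) ≤
          ∑ j ∈ Finset.range d, lam0 j + ∑ p ∈ F, tlamSeq (K p.1) p.2 →
        approxComplexity (P d) (Y d) ε ≤ F.card + 1) ∧
      ∀ τ, 0 < τ → (1 - ε ^ 2) * ∑ j ∈ Finset.range d, lamTrace (K j) ≤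
        ∑ j ∈ Finset.range d, lam0 j +
          ∑ j ∈ Finset.range d, ∑' k, max (tlamSeq (K j) k - τ) 0 +
          τ * approxComplexity (P d) (Y d) ε := by
  classical
  choose ι b ν i₀ hb0 hν0 hνnn hb hq using fun j =>
    exists_marginal_basis (P' j) (X j) (hX j) (K j) (hK j) (hKcont j) (lam0 j) (hlam0 j)
  have hL2 : ∀ d, IsL2Field (P d) (Y d) := fun d =>
    isL2Field_additive (P d) (Y d) (hY d) (hYmeas d) K hKcont (hYcov d)
  have htrace := fun d => additive_trace (P d) (Y d) (hL2 d) K hKcont (hYcov d) b ν hνnn hq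
  -- The coordinate j, counted from 0, is present in the field of dimension j + 1.
  have hsum : ∀ j, Summable (ν j) := fun j => (htrace (j + 1)).1 ⟨j, Nat.lt_succ_self j⟩
  have hsymm : ∀ j, (kernelOp (K j) (hKcont j) :
      Lp ℝ 2 (volume : Measure I) →ₗ[ℝ] _).IsSymmetric := fun j f g => by
    have h := hKcont j
    simp only [hK j] at h
    have := isSymmetric_kernelOp_covFunc (P' j) (X j) (hX j) h f g
    simp only [hK j]
    exact this
  choose t0 tanti tsumm ttr ltr v hv hv1 hvq using fun j =>
    marginal_rearrangement (K j) (hKcont j) (hsymm j) (b j) (ν j) (i₀ j) (hb0 j) (hνnn j) (hb j)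
      (hq j) (hsum j)
  have hl0 : ∀ j, 0 ≤ lam0 j := fun j => hν0 j ▸ hνnn j (i₀ j)
  have hltr : ∀ j, lamTrace (K j) = lam0 j + tlamTrace (K j) := fun j => by
    rw [ltr, ← ttr, hν0, add_comm]
  refine ⟨fun j => ⟨hl0 j, t0 j, tanti j, tsumm j, hltr j⟩, fun d ε hε => ?_⟩
  have restrict : ∀ (G : ℝ → ℝ), G 0 = 0 → ∀ j, (Summable fun k => G (tlamSeq (K j) k)) →
      HasSum (fun k : {k // 0 < tlamSeq (K j) k} => G (tlamSeq (K j) k))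
        (∑' k, G (tlamSeq (K j) k)) := by
    intro G hG j hs
    refine (Subtype.val_injective.hasSum_iff (f := fun k => G (tlamSeq (K j) k)) fun k hk => ?_).2
      hs.hasSum
    have : tlamSeq (K j) k = 0 := by
      by_contra hne
      exact hk ⟨⟨k, lt_of_le_of_ne (t0 j k) (Ne.symm hne)⟩, rfl⟩
    rw [this, hG]
  let α := Unit ⊕ (Σ j : Fin d, {k // 0 < tlamSeq (K j) k})
  let c : ℝ := ∑ j ∈ Finset.range d, lam0 j
  let ev : α → ℝ := Sum.elim (fun _ => c) fun p => tlamSeq (K p.1) p.2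
  have hc : 0 ≤ c := Finset.sum_nonneg fun j _ => hl0 j
  have hev : ∀ a, 0 ≤ ev a := by
    rintro (_ | p)
    · exact hc
    · exact p.2.2.le
  have hevsum : HasSum ev (∑ j ∈ Finset.range d, lamTrace (K j)) := by
    have := hasSum_unit_sum_sigma (d := d) c
      (fun j (k : {k // 0 < tlamSeq (K j) k}) => tlamSeq (K j) k)
      (fun j k => k.2.le) (fun j => tlamTrace (K j)) (fun j => restrict id rfl j (tsumm j))
    rw [Fin.sum_univ_eq_sum_range (fun j => tlamTrace (K j)), ← Finset.sum_add_distrib] at this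
    simpa only [hltr] using this
  have hD : HasSum ev (∫ ω, ‖sampleLp (Y d) ω‖ ^ 2 ∂(P d)) := by
    rw [(htrace d).2, Fin.sum_univ_eq_sum_range (fun j => ∑' i, ν j i)]
    simpa only [ltr] using hevsum
  have hquad : ∀ g, HasSum (fun a => ev a * inner ℝ (additiveFamily (d := d) v a) g ^ 2)
      (∫ ω, pairing (Y d) g ω ^ 2 ∂(P d)) := by
    intro g
    rw [(hL2 d).integral_pairing_sq]
    simp only [hYcov]
    rw [integral_additive_kernel K hKcont]
    -- The projection onto coordinate j pairs with 1 as g pairs with the constant on the cube,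
    -- whatever j is, so the subtracted terms add up to c ⟨1, g⟩².
    have h1 : ∀ j : Fin d, HasSum
        (fun k => tlamSeq (K j) k.1 * inner ℝ (coordEmb j (v j k)) g ^ 2)
        (inner ℝ (kernelOp (K j) (hKcont j) (coordProj j g)) (coordProj j g) -
          lam0 j * inner ℝ (oneCube d) g ^ 2) := by
      intro j
      have := hvq j (coordProj j g)
      simp only [inner_coordProj, coordEmb_oneL2, hν0] at this
      rw [inner_coordProj]
      exact this
    have h2 : Summable fun p : Σ j : Fin d, {k // 0 < tlamSeq (K j) k} =>
        tlamSeq (K p.1) p.2.1 * inner ℝ (coordEmb p.1 (v p.1 p.2)) g ^ 2 :=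
      (summable_sigma_of_nonneg fun p => mul_nonneg p.2.2.le (sq_nonneg _)).2
        ⟨fun j => (h1 j).summable, (hasSum_fintype _).summable⟩
    have h3 := HasSum.sum (f := fun a => ev a * inner ℝ (additiveFamily (d := d) v a) g ^ 2)
      (hasSum_unique _) (HasSum.sigma_of_hasSum (hasSum_fintype _) h1 h2)
    convert h3 using 1
    rw [Finset.sum_sub_distrib, ← Finset.sum_mul, Fin.sum_univ_eq_sum_range lam0]
    show _ = c * inner ℝ (oneCube d) g ^ 2 + _
    ring
  have hB := (hL2 d).approxComplexity_bounds (orthonormal_additiveFamily (d := d) v hv hv1) hev hD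
    hquad hε
  rw [hevsum.tsum_eq] at hB
  refine ⟨fun F hF hle => ?_, fun τ hτ => ?_⟩
  · let E : F → Σ j : Fin d, {k // 0 < tlamSeq (K j) k} := fun p => ⟨p.1.1, p.1.2, hF p p.2⟩
    have hE : Function.Injective E := by
      rintro ⟨⟨j, k⟩, hp⟩ ⟨⟨j', k'⟩, hp'⟩ h
      simp only [E, Sigma.mk.injEq] at h
      obtain ⟨rfl, h2⟩ := h
      simpa using h2
    let F' : Finset α := Finset.disjSum {()} (F.attach.map ⟨E, hE⟩)
    have := hB.1 F' ⟨Sum.inl (), by simp [F']⟩ (by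
      simp only [F', Finset.sum_disjSum, Finset.sum_singleton, Finset.sum_map]
      refine hle.trans_eq ?_
      congr 1
      exact (Finset.sum_attach F fun p => tlamSeq (K p.1) p.2).symm)
    refine this.trans_eq ?_
    simp [F', add_comm]
  · refine (hB.2 τ hτ).trans ?_
    gcongr
    have hm : ∀ j, Summable fun k => max (tlamSeq (K j) k - τ) 0 := fun j =>
      (tsumm j).of_nonneg_of_le (fun k => le_max_right _ _)
        fun k => max_le (by linarith) (t0 j k)
    have h1 := hasSum_unit_sum_sigma (d := d) (max (c - τ) 0)
      (fun j (k : {k // 0 < tlamSeq (K j) k}) => max (tlamSeq (K j) k - τ) 0)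
      (fun j k => le_max_right _ _) (fun j => ∑' k, max (tlamSeq (K j) k - τ) 0)
      (fun j => restrict (fun x => max (x - τ) 0) (by simp [hτ.le]) j (hm j))
    rw [Fin.sum_univ_eq_sum_range (fun j => ∑' k, max (tlamSeq (K j) k - τ) 0)] at h1
    have h2 : (fun a => max (ev a - τ) 0) = Sum.elim (fun _ => max (c - τ) 0)
        fun p : Σ j : Fin d, {k // 0 < tlamSeq (K j) k} => max (tlamSeq (K p.1) p.2 - τ) 0 := by
      funext a; rcases a with _ | p <;> rfl
    rw [h2, h1.tsum_eq]
    gcongr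
    -- The constant enters the dual bound through (c − τ)⁺ ≤ c.
    exact max_le (by linarith) hc

/-! ### Weak convergence of the eigenvalue distributions. -/

theorem measureReal_Iic_of_isDistributionFunction {F : StieltjesFunction ℝ}
    (hF : IsDistributionFunction F) (x : ℝ) : F.measure.real (Set.Iic x) = F x := by
  rw [Measure.real, F.measure_Iic hF.1, sub_zero, ENNReal.toReal_ofReal]
  exact le_of_tendsto hF.1 ((eventually_le_atBot x).mono fun y hy => F.mono hy)

/-- Convergence of the distribution functions at the continuity points of the limit implies weak
convergence. -/
theorem tendsto_probabilityMeasure_of_tendsto_cdf {μ : ℕ → ProbabilityMeasure ℝ}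
    {ν : ProbabilityMeasure ℝ} {F : StieltjesFunction ℝ} (hF : IsDistributionFunction F)
    (hν : (ν : Measure ℝ) = F.measure)
    (h : ∀ x, ContinuousAt F x →
      Tendsto (fun n => (μ n : Measure ℝ).real (Set.Iic x)) atTop (𝓝 (F x))) :
    Tendsto μ atTop (𝓝 ν) := by
  -- A monotone function has countably many discontinuities, so these intervals form a π-system
  -- containing arbitrarily small neighborhoods of each point; convergence on it suffices.
  let S : Set (Set ℝ) := {s | ∃ a b, ContinuousAt F a ∧ ContinuousAt F b ∧ s = Set.Ioc a b}
  have hcont : ∀ a b : ℝ, ContinuousAt F a → ContinuousAt F b → ContinuousAt F (max a b) ∧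
      ContinuousAt F (min a b) := fun a b ha hb => by
    rcases le_total a b with hab | hab <;> simp [hab, ha, hb]
  have hS : IsPiSystem S := by
    rintro _ ⟨a, b, ha, hb, rfl⟩ _ ⟨a', b', ha', hb', rfl⟩ -
    exact ⟨_, _, (hcont a a' ha ha').1, (hcont b b' hb hb').2, Set.Ioc_inter_Ioc⟩
  refine hS.tendsto_probabilityMeasure_of_tendsto_of_mem ?_ ?_ ?_
  · rintro _ ⟨a, b, -, -, rfl⟩
    exact measurableSet_Ioc
  · intro u hu x hx
    have hdense : Dense {y | ContinuousAt F y} := by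
      have := (F.mono.countable_not_continuousAt).dense_compl ℝ
      simpa [Set.compl_ofPred] using this
    obtain ⟨δ, hδ, hball⟩ := Metric.isOpen_iff.1 hu x hx
    obtain ⟨a, ha, ha'⟩ := hdense.exists_between (show x - δ < x by linarith)
    obtain ⟨b, hb, hb'⟩ := hdense.exists_between (show x < x + δ by linarith)
    refine ⟨Set.Ioc a b, ⟨a, b, ha, hb, rfl⟩, Ioc_mem_nhds ha'.2 hb'.1, fun y hy => hball ?_⟩
    rw [Metric.mem_ball, Real.dist_eq, abs_lt]
    constructor <;> linarith [hy.1, hy.2, ha'.1, hb'.2]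
  · rintro _ ⟨a, b, ha, hb, rfl⟩
    rw [← NNReal.tendsto_coe]
    show Tendsto (fun n => (μ n : Measure ℝ).real (Set.Ioc a b)) atTop
      (𝓝 ((ν : Measure ℝ).real (Set.Ioc a b)))
    rcases le_or_gt a b with hab | hab
    · have hIoc : ∀ m : ProbabilityMeasure ℝ, (m : Measure ℝ).real (Set.Ioc a b) =
          (m : Measure ℝ).real (Set.Iic b) - (m : Measure ℝ).real (Set.Iic a) := by
        intro m
        rw [← Set.Iic_sdiff_Iic, measureReal_sdiff (Set.Iic_subset_Iic.2 hab) measurableSet_Iic]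
      simp only [hIoc]
      rw [hν, measureReal_Iic_of_isDistributionFunction hF,
        measureReal_Iic_of_isDistributionFunction hF]
      exact (h b hb).sub (h a ha)
    · simp [Set.Ioc_eq_empty_of_le hab.le]

/-- The discrete distribution with weights proportional to `p k` at the points `x k`. -/
def discreteMeasure (p x : ℕ → ℝ) : Measure ℝ :=
  Measure.sum fun k => ENNReal.ofReal (p k / ∑' l, p l) • Measure.dirac (x k)

theorem isProbabilityMeasure_discreteMeasure {p : ℕ → ℝ} (x : ℕ → ℝ) (hp : ∀ k, 0 ≤ p k)
    (hs : Summable p) (hpos : 0 < ∑' k, p k) : IsProbabilityMeasure (discreteMeasure p x) := by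
  refine ⟨?_⟩
  rw [discreteMeasure, Measure.sum_apply _ MeasurableSet.univ]
  simp only [Measure.smul_apply, measure_univ, smul_eq_mul, mul_one]
  rw [← ENNReal.ofReal_tsum_of_nonneg (fun k => div_nonneg (hp k) hpos.le) (hs.div_const _),
    tsum_div_const, div_self hpos.ne', ENNReal.ofReal_one]

theorem integral_discreteMeasure {p : ℕ → ℝ} (x : ℕ → ℝ) (hp : ∀ k, 0 ≤ p k) {f : ℝ → ℝ}
    (hf : Integrable f (discreteMeasure p x)) :
    ∫ y, f y ∂discreteMeasure p x = (∑' k, p k * f (x k)) / ∑' l, p l := by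
  rw [discreteMeasure, integral_sum_measure hf, ← tsum_div_const]
  refine tsum_congr fun k => ?_
  rw [integral_smul_measure, integral_dirac, ENNReal.toReal_ofReal
    (div_nonneg (hp k) (tsum_nonneg hp)), smul_eq_mul]
  ring

theorem measureReal_Iic_discreteMeasure {p : ℕ → ℝ} (x : ℕ → ℝ) (hp : ∀ k, 0 ≤ p k)
    (hs : Summable p) (hpos : 0 < ∑' k, p k) (c : ℝ) :
    (discreteMeasure p x).real (Set.Iic c) =
      1 / (∑' l, p l) * ∑' k, if x k ≤ c then p k else 0 := by
  have := isProbabilityMeasure_discreteMeasure x hp hs hpos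
  have hi : Integrable ((Set.Iic c).indicator (1 : ℝ → ℝ)) (discreteMeasure p x) :=
    (integrable_const (1 : ℝ)).indicator measurableSet_Iic
  rw [← integral_indicator_one measurableSet_Iic, integral_discreteMeasure x hp hi, one_div,
    inv_mul_eq_div]
  congr 1
  refine tsum_congr fun k => ?_
  by_cases h : x k ≤ c <;> simp [h]

/-- The mixture of the shifts of the distributions `m j`, `j < d`, by `c j`, with weights
proportional to `L j`. -/
def shiftMixture (L : ℕ → ℝ) (m : ℕ → ProbabilityMeasure ℝ) (c : ℕ → ℝ) (d : ℕ) : Measure ℝ :=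
  ∑ j ∈ Finset.range d, ENNReal.ofReal (L j / ∑ i ∈ Finset.range d, L i) •
    (m j : Measure ℝ).map (· + c j)

theorem isProbabilityMeasure_shiftMixture {L : ℕ → ℝ} (m : ℕ → ProbabilityMeasure ℝ) (c : ℕ → ℝ)
    {d : ℕ} (hL : ∀ j, 0 ≤ L j) (hpos : 0 < ∑ i ∈ Finset.range d, L i) :
    IsProbabilityMeasure (shiftMixture L m c d) := by
  refine ⟨?_⟩
  have h1 : ∀ j, ((m j : Measure ℝ).map (· + c j)) Set.univ = 1 := fun j => by
    rw [Measure.map_apply (by fun_prop) MeasurableSet.univ]; simp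
  simp only [shiftMixture, Measure.finsetSum_apply, Measure.smul_apply, h1, smul_eq_mul, mul_one]
  rw [← ENNReal.ofReal_sum_of_nonneg fun j _ => div_nonneg (hL j) hpos.le, ← Finset.sum_div,
    div_self hpos.ne', ENNReal.ofReal_one]

theorem integral_shiftMixture {E : Type*} [NormedAddCommGroup E] [NormedSpace ℝ E]
    {L : ℕ → ℝ} (m : ℕ → ProbabilityMeasure ℝ) (c : ℕ → ℝ) {d : ℕ} (hL : ∀ j, 0 ≤ L j)
    {f : ℝ → E} (hf : ∀ j, Integrable f ((m j : Measure ℝ).map (· + c j))) :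
    ∫ y, f y ∂shiftMixture L m c d = ∑ j ∈ Finset.range d,
      (L j / ∑ i ∈ Finset.range d, L i) • ∫ y, f y ∂((m j : Measure ℝ).map (· + c j)) := by
  rw [shiftMixture, integral_finsetSum_measure fun j _ => (hf j).smul_measure ENNReal.ofReal_ne_top]
  refine Finset.sum_congr rfl fun j _ => ?_
  rw [integral_smul_measure, ENNReal.toReal_ofReal
    (div_nonneg (hL j) (Finset.sum_nonneg fun i _ => hL i))]

theorem charFun_shiftMixture {L : ℕ → ℝ} (m : ℕ → ProbabilityMeasure ℝ) (c : ℕ → ℝ) {d : ℕ}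
    (hL : ∀ j, 0 ≤ L j) (t : ℝ) :
    charFun (shiftMixture L m c d) t = ∑ j ∈ Finset.range d,
      (L j / ∑ i ∈ Finset.range d, L i) •
        (charFun (m j : Measure ℝ) t * Complex.exp ((c j * t : ℝ) * Complex.I)) := by
  have h : ∀ j, IsProbabilityMeasure ((m j : Measure ℝ).map (· + c j)) := fun j =>
    Measure.isProbabilityMeasure_map (by fun_prop)
  rw [charFun_eq_integral_innerProbChar, integral_shiftMixture m c hL fun j =>
    BoundedContinuousFunction.integrable _ _]
  refine Finset.sum_congr rfl fun j _ => ?_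
  rw [← charFun_eq_integral_innerProbChar, charFun_map_add_const]
  simp [mul_comm]

open Classical in
/-- A measure as a probability measure, when it is one. -/
def toProbabilityMeasure (μ : Measure ℝ) : ProbabilityMeasure ℝ :=
  if h : IsProbabilityMeasure μ then (⟨μ, h⟩ : ProbabilityMeasure ℝ)
  else (⟨Measure.dirac 0, inferInstance⟩ : ProbabilityMeasure ℝ)

theorem coe_toProbabilityMeasure (μ : Measure ℝ) (h : IsProbabilityMeasure μ) :
    (toProbabilityMeasure μ : Measure ℝ) = μ := by
  unfold toProbabilityMeasure
  exact congrArg (fun m : ProbabilityMeasure ℝ => (m : Measure ℝ)) (dif_pos h)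

/-- Mixtures of shifts of a weakly convergent sequence behave like the convolution of the limit with
the mixing distribution, when the total weight is infinite. -/
theorem tendsto_integral_shiftMixture {L : ℕ → ℝ} (hL : ∀ j, 0 ≤ L j)
    (hS : Tendsto (fun d => ∑ j ∈ Finset.range d, L j) atTop atTop)
    {m : ℕ → ProbabilityMeasure ℝ} {μ : ProbabilityMeasure ℝ} (hm : Tendsto m atTop (𝓝 μ))
    (c : ℕ → ℕ → ℝ) (ρ : Measure ℝ) [IsProbabilityMeasure ρ]
    (hc : ∀ t, Tendsto (fun d => ∑ j ∈ Finset.range d, (L j / ∑ i ∈ Finset.range d, L i) •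
      Complex.exp ((c d j * t : ℝ) * Complex.I)) atTop (𝓝 (charFun ρ t)))
    (f : BoundedContinuousFunction ℝ ℝ) :
    Tendsto (fun d => ∫ y, f y ∂shiftMixture L m (c d) d) atTop
      (𝓝 (∫ y, f y ∂((μ : Measure ℝ).conv ρ))) := by
  have hprob : ∀ᶠ d in atTop, IsProbabilityMeasure (shiftMixture L m (c d) d) := by
    filter_upwards [hS.eventually_gt_atTop 0] with d hd
    exact isProbabilityMeasure_shiftMixture m (c d) hL hd
  have hweak : Tendsto (fun d => toProbabilityMeasure (shiftMixture L m (c d) d)) atTop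
      (𝓝 (⟨(μ : Measure ℝ).conv ρ, inferInstance⟩ : ProbabilityMeasure ℝ)) := by
    refine ProbabilityMeasure.tendsto_of_tendsto_charFun fun t => ?_
    have hlim : Tendsto (fun d => charFun (shiftMixture L m (c d) d) t) atTop
        (𝓝 (charFun ((μ : Measure ℝ).conv ρ) t)) := by
      rw [charFun_conv]
      have h1 := (ProbabilityMeasure.tendsto_iff_tendsto_charFun.1 hm t)
      -- Replacing m j by its limit is a weighted Cesàro argument: the error is o(L j) termwise, and
      -- since ∑ L diverges its partial sums are o(∑ L). The phase factors have modulus 1.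
      have h2 : (fun j => (L j : ℝ) • (charFun (m j : Measure ℝ) t - charFun (μ : Measure ℝ) t))
          =o[atTop] L := by
        have : (fun j => charFun (m j : Measure ℝ) t - charFun (μ : Measure ℝ) t) =o[atTop]
            fun _ => (1 : ℝ) := by
          rw [Asymptotics.isLittleO_one_iff]
          simpa using h1.sub_const (charFun (μ : Measure ℝ) t)
        simpa using (Asymptotics.isBigO_refl L atTop).smul_isLittleO this
      have h3 : Tendsto (fun d => ∑ j ∈ Finset.range d, (L j / ∑ i ∈ Finset.range d, L i) •
          ((charFun (m j : Measure ℝ) t - charFun (μ : Measure ℝ) t) *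
            Complex.exp ((c d j * t : ℝ) * Complex.I))) atTop (𝓝 0) := by
        have h4 := (h2.norm_left).sum_range hL hS
        refine squeeze_zero_norm (fun d => ?_) h4.tendsto_div_nhds_zero
        refine (norm_sum_le _ _).trans ?_
        rw [Finset.sum_div]
        refine Finset.sum_le_sum fun j _ => ?_
        rw [norm_smul, norm_smul, norm_mul, Complex.norm_exp_ofReal_mul_I, mul_one, norm_div,
          Real.norm_of_nonneg (Finset.sum_nonneg fun i _ => hL i)]
        exact (div_mul_eq_mul_div _ _ _).le
      have h5 := h3.add ((hc t).const_mul (charFun (μ : Measure ℝ) t))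
      rw [zero_add] at h5
      refine h5.congr fun d => ?_
      rw [charFun_shiftMixture m (c d) hL, Finset.mul_sum, ← Finset.sum_add_distrib]
      refine Finset.sum_congr rfl fun j _ => ?_
      rw [mul_smul_comm, ← smul_add]
      congr 1
      ring
    refine hlim.congr' ?_
    filter_upwards [hprob] with d hd
    rw [coe_toProbabilityMeasure _ hd]
  have := (ProbabilityMeasure.tendsto_iff_forall_integral_tendsto.1 hweak f)
  refine this.congr' ?_
  filter_upwards [hprob] with d hd
  rw [coe_toProbabilityMeasure _ hd]

/-- If the total weight is zero, the averaged expression is 0 because 1/0 = 0, whereas it must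
converge to a positive value at a continuity point where U > 0. -/
theorem eventually_tsum_pos {p : ℕ → ℕ → ℝ} (hp : ∀ j k, 0 ≤ p j k)
    (U : StieltjesFunction ℝ) (hU : IsDistributionFunction U) (ℓ : ℕ → ℝ)
    (hUconv : ∀ x, ContinuousAt U x → Tendsto
      (fun j : ℕ => 1 / (∑' k, p j k) *
        ∑' k, if -Real.log (p j k) - ℓ j ≤ x then p j k else 0) atTop (𝓝 (U x))) :
    ∀ᶠ j in atTop, 0 < ∑' k, p j k := by
  obtain ⟨x, hx, hx'⟩ : ∃ x, ContinuousAt U x ∧ 0 < U x := by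
    obtain ⟨N, hN⟩ := (hU.2.eventually (lt_mem_nhds one_pos)).exists_forall_of_atTop
    have hdense : Dense {y | ContinuousAt U y} := by
      have := (U.mono.countable_not_continuousAt).dense_compl ℝ
      simpa [Set.compl_ofPred] using this
    obtain ⟨x, hx, hx'⟩ := hdense.exists_between (show N < N + 1 by linarith)
    exact ⟨x, hx, hN x hx'.1.le⟩
  filter_upwards [(hUconv x hx).eventually (lt_mem_nhds hx')] with j hj
  refine lt_of_le_of_ne (tsum_nonneg (hp j)) fun h0 => ?_
  rw [← h0] at hj
  simp at hj

/-- The weak limit of the distributions of the logarithms of all marginal eigenvalues. -/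
theorem tendsto_eigenvalue_average {p : ℕ → ℕ → ℝ} (hp : ∀ j k, 0 ≤ p j k)
    (hps : ∀ j, Summable (p j))
    (hS : Tendsto (fun d => ∑ j ∈ Finset.range d, ∑' k, p j k) atTop atTop)
    (U : StieltjesFunction ℝ) (hU : IsDistributionFunction U) (ℓ : ℕ → ℝ)
    (hUconv : ∀ x, ContinuousAt U x → Tendsto
      (fun j : ℕ => 1 / (∑' k, p j k) *
        ∑' k, if -Real.log (p j k) - ℓ j ≤ x then p j k else 0) atTop (𝓝 (U x)))
    (sgn : ℝ) (hsgn : sgn * sgn = 1)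
    (W : StieltjesFunction ℝ) (hW : IsDistributionFunction W) (a : ℕ → ℝ)
    (hWconv : ∀ x, ContinuousAt W x → Tendsto
      (fun d : ℕ =>
        (∑ j ∈ Finset.range d, if sgn * (ℓ j - a d) ≤ x then ∑' k, p j k else 0) /
          ∑ m ∈ Finset.range d, ∑' k, p m k) atTop (𝓝 (W x)))
    (f : BoundedContinuousFunction ℝ ℝ) :
    Tendsto (fun d : ℕ => (∑ j ∈ Finset.range d, ∑' k, p j k * f (-Real.log (p j k) - a d)) /
      ∑ j ∈ Finset.range d, ∑' k, p j k) atTop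
      (𝓝 (∫ y, f y ∂(U.measure.conv (W.measure.map (sgn * ·))))) := by
  have hUp : IsProbabilityMeasure U.measure := U.isProbabilityMeasure hU.1 hU.2
  have hWp : IsProbabilityMeasure W.measure := W.isProbabilityMeasure hW.1 hW.2
  have hρp : IsProbabilityMeasure (W.measure.map (sgn * ·)) :=
    Measure.isProbabilityMeasure_map (by fun_prop)
  set L : ℕ → ℝ := fun j => ∑' k, p j k with hLdef
  have hL : ∀ j, 0 ≤ L j := fun j => tsum_nonneg (hp j)
  have hLpos : ∀ᶠ j in atTop, 0 < L j := eventually_tsum_pos hp U hU ℓ hUconv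
  -- For the finitely many j of zero total weight this is a default Dirac mass, harmless because its
  -- weight in every mixture is zero.
  let m : ℕ → ProbabilityMeasure ℝ := fun j =>
    toProbabilityMeasure (discreteMeasure (p j) fun k => -Real.log (p j k) - ℓ j)
  have hmcoe : ∀ j, 0 < L j → (m j : Measure ℝ) =
      discreteMeasure (p j) fun k => -Real.log (p j k) - ℓ j := fun j hj =>
    coe_toProbabilityMeasure _ (isProbabilityMeasure_discreteMeasure _ (hp j) (hps j) hj)
  have hm : Tendsto m atTop (𝓝 (⟨U.measure, hUp⟩ : ProbabilityMeasure ℝ)) := by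
    refine tendsto_probabilityMeasure_of_tendsto_cdf hU rfl fun x hx => ?_
    refine (hUconv x hx).congr' ?_
    filter_upwards [hLpos] with j hj
    rw [hmcoe j hj, measureReal_Iic_discreteMeasure _ (hp j) (hps j) hj]
  let δ₀ : ProbabilityMeasure ℝ := ⟨Measure.dirac 0, inferInstance⟩
  have hprob : ∀ᶠ d in atTop, IsProbabilityMeasure
      (shiftMixture L (fun _ => δ₀) (fun j => sgn * (ℓ j - a d)) d) := by
    filter_upwards [hS.eventually_gt_atTop 0] with d hd
    exact isProbabilityMeasure_shiftMixture _ _ hL hd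
  have hw : Tendsto (fun d => toProbabilityMeasure
      (shiftMixture L (fun _ => δ₀) (fun j => sgn * (ℓ j - a d)) d)) atTop
      (𝓝 (⟨W.measure, hWp⟩ : ProbabilityMeasure ℝ)) := by
    refine tendsto_probabilityMeasure_of_tendsto_cdf hW rfl fun x hx => ?_
    refine (hWconv x hx).congr' ?_
    filter_upwards [hprob] with d hd
    rw [coe_toProbabilityMeasure _ hd, ← integral_indicator_one measurableSet_Iic,
      integral_shiftMixture _ _ hL, Finset.sum_div]
    · refine Finset.sum_congr rfl fun j _ => ?_
      have : ((δ₀ : Measure ℝ).map (· + sgn * (ℓ j - a d))) =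
          Measure.dirac (sgn * (ℓ j - a d)) := by
        show (Measure.dirac (0 : ℝ)).map _ = _
        rw [Measure.map_dirac' (by fun_prop), zero_add]
      rw [this, integral_dirac]
      by_cases h : sgn * (ℓ j - a d) ≤ x
      · simp [h]; rfl
      · simp [h]
    · intro j
      have : IsProbabilityMeasure ((δ₀ : Measure ℝ).map (· + sgn * (ℓ j - a d))) :=
        Measure.isProbabilityMeasure_map (by fun_prop)
      exact (integrable_const (1 : ℝ)).indicator measurableSet_Iic
  -- Since sgn² = 1, the characteristic function of the law of sgn·(ℓ_j − a_d), taken at sgn·t, is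
  -- that of the law of ℓ_j − a_d at t.
  have hc : ∀ t, Tendsto (fun d => ∑ j ∈ Finset.range d, (L j / ∑ i ∈ Finset.range d, L i) •
      Complex.exp (((ℓ j - a d) * t : ℝ) * Complex.I)) atTop
      (𝓝 (charFun (W.measure.map (sgn * ·)) t)) := by
    intro t
    rw [charFun_map_mul]
    refine (ProbabilityMeasure.tendsto_iff_tendsto_charFun.1 hw (sgn * t)).congr' ?_
    filter_upwards [hprob] with d hd
    rw [coe_toProbabilityMeasure _ hd, charFun_shiftMixture _ _ hL]
    refine Finset.sum_congr rfl fun j _ => ?_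
    have h1 : charFun (δ₀ : Measure ℝ) (sgn * t) = 1 := by
      show charFun (Measure.dirac (0 : ℝ)) _ = 1
      rw [charFun_dirac]; simp
    rw [h1, one_mul]
    congr 4
    linear_combination (ℓ j - a d) * t * hsgn
  refine (tendsto_integral_shiftMixture hL hS hm (fun d j => ℓ j - a d) _ hc f).congr fun d => ?_
  have hfi : ∀ j, IsProbabilityMeasure ((m j : Measure ℝ).map (· + (ℓ j - a d))) := fun j =>
    Measure.isProbabilityMeasure_map (by fun_prop)
  rw [integral_shiftMixture _ _ hL fun j => f.integrable _, Finset.sum_div]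
  refine Finset.sum_congr rfl fun j _ => ?_
  rcases (hL j).eq_or_lt with h0 | h0
  · have : ∀ k, p j k = 0 := fun k =>
      le_antisymm (((hps j).le_tsum k fun _ _ => hp j _).trans_eq h0.symm) (hp j k)
    simp [← h0, this]
  · rw [integral_map (by fun_prop) f.continuous.aestronglyMeasurable, hmcoe j h0]
    have := isProbabilityMeasure_discreteMeasure
      (fun k => -Real.log (p j k) - ℓ j) (hp j) (hps j) h0
    let g : BoundedContinuousFunction ℝ ℝ :=
      f.compContinuous ⟨fun y => y + (ℓ j - a d), by fun_prop⟩
    have h2 := integral_discreteMeasure (fun k => -Real.log (p j k) - ℓ j) (hp j)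
      (g.integrable (discreteMeasure (p j) fun k => -Real.log (p j k) - ℓ j))
    have h3 : ∀ k, g (-Real.log (p j k) - ℓ j) = f (-Real.log (p j k) - a d) := fun k => by
      show f (-Real.log (p j k) - ℓ j + (ℓ j - a d)) = _
      congr 1
      ring
    simp only [h3] at h2
    rw [show ∫ y, f (y + (ℓ j - a d)) ∂(discreteMeasure (p j) fun k => -Real.log (p j k) - ℓ j) =
      ∫ y, g y ∂(discreteMeasure (p j) fun k => -Real.log (p j k) - ℓ j) from rfl, h2, smul_eq_mul]
    have h0' : ∑' l, p j l ≠ 0 := h0.ne'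
    simp only [L]
    field_simp

theorem measureReal_Iic_conv (U W : StieltjesFunction ℝ) (hU : IsDistributionFunction U)
    (hW : IsDistributionFunction W) (sgn x : ℝ) :
    (U.measure.conv (W.measure.map (sgn * ·))).real (Set.Iic x) =
      ∫ v, U (x - sgn * v) ∂W.measure := by
  have hUp : IsProbabilityMeasure U.measure := U.isProbabilityMeasure hU.1 hU.2
  have hWp : IsProbabilityMeasure W.measure := W.isProbabilityMeasure hW.1 hW.2
  have hρp : IsProbabilityMeasure (W.measure.map (sgn * ·)) :=
    Measure.isProbabilityMeasure_map (by fun_prop)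
  have hmeas : Measurable fun v => U (x - sgn * v) := U.mono.measurable.comp (by fun_prop)
  have hset : MeasurableSet ((fun q : ℝ × ℝ => q.1 + q.2) ⁻¹' Set.Iic x) :=
    measurable_add measurableSet_Iic
  rw [Measure.real, Measure.conv, Measure.map_apply measurable_add measurableSet_Iic,
    Measure.prod_apply_symm hset, lintegral_map (measurable_measure_prodMk_right hset)
      (by fun_prop), integral_eq_lintegral_of_nonneg_ae (.of_forall fun v => ?_)
      hmeas.aestronglyMeasurable]
  · congr 1
    refine lintegral_congr fun v => ?_
    rw [← measureReal_Iic_of_isDistributionFunction hU, ofReal_measureReal]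
    congr 1
    ext y
    simp [le_sub_iff_add_le]
  · simp only [Pi.zero_apply]
    rw [← measureReal_Iic_of_isDistributionFunction hU]
    exact measureReal_nonneg

/-! ### The quantile transform and the integral of exp F⁻¹. -/

section Quantile

variable (μ : Measure ℝ)

/-- Right-continuity makes the infimum attained. The limits at ±∞ make the set nonempty and bounded
below, for which 0 < y < 1 is needed. -/
theorem genInverse_cdf_le_iff {y : ℝ} (hy : y ∈ Set.Ioo (0 : ℝ) 1) (x : ℝ) :
    genInverse (cdf μ) y ≤ x ↔ y ≤ cdf μ x := by
  have hne : {x | y ≤ cdf μ x}.Nonempty := by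
    obtain ⟨x, hx⟩ := ((tendsto_cdf_atTop μ).eventually (lt_mem_nhds hy.2)).exists
    exact ⟨x, hx.le⟩
  have hbdd : BddBelow {x | y ≤ cdf μ x} := by
    obtain ⟨b, hb⟩ := ((tendsto_cdf_atBot μ).eventually (gt_mem_nhds hy.1)).exists
    refine ⟨b, fun x hx => ?_⟩
    by_contra hlt
    have h1 := monotone_cdf μ (not_le.1 hlt).le
    have h2 : y ≤ cdf μ x := hx
    linarith
  constructor
  · intro h
    refine le_trans ?_ (monotone_cdf μ h)
    have hr : Tendsto (cdf μ) (𝓝[>] (genInverse (cdf μ) y)) (𝓝 (cdf μ (genInverse (cdf μ) y))) :=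
      ((cdf μ).right_continuous _).mono Set.Ioi_subset_Ici_self
    refine ge_of_tendsto hr ?_
    filter_upwards [self_mem_nhdsWithin] with x' hx'
    obtain ⟨z, hz, hzx⟩ := exists_lt_of_csInf_lt hne hx'
    exact le_trans hz (monotone_cdf μ hzx.le)
  · intro h
    exact csInf_le hbdd h

theorem monotoneOn_genInverse_cdf : MonotoneOn (genInverse (cdf μ)) (Set.Ioo 0 1) := by
  intro y hy z hz hyz
  rw [genInverse_cdf_le_iff μ hy]
  exact hyz.trans ((genInverse_cdf_le_iff μ hz _).1 le_rfl)

theorem aemeasurable_genInverse_cdf :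
    AEMeasurable (genInverse (cdf μ)) (volume.restrict (Set.Ioo 0 1)) :=
  aemeasurable_restrict_of_monotoneOn measurableSet_Ioo (monotoneOn_genInverse_cdf μ)

theorem integrableOn_exp_genInverse {q : ℝ} (hq : q ∈ Set.Ioo (0 : ℝ) 1) :
    IntegrableOn (fun y => Real.exp (genInverse (cdf μ) y)) (Set.Ioc 0 q) := by
  have hsub : Set.Ioc 0 q ⊆ Set.Ioo (0 : ℝ) 1 := fun y hy => ⟨hy.1, hy.2.trans_lt hq.2⟩
  refine Integrable.of_bound (Real.measurable_exp.comp_aemeasurable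
      ((aemeasurable_genInverse_cdf μ).mono_measure (Measure.restrict_mono hsub le_rfl))
      ).aestronglyMeasurable (Real.exp (genInverse (cdf μ) q)) ?_
  filter_upwards [ae_restrict_mem measurableSet_Ioc] with y hy
  rw [Real.norm_eq_abs, Real.abs_exp]
  exact Real.exp_le_exp.2 (monotoneOn_genInverse_cdf μ (hsub hy) hq hy.2)

theorem integral_exp_genInverse_pos {q : ℝ} (hq : q ∈ Set.Ioo (0 : ℝ) 1) :
    0 < ∫ y in (0 : ℝ)..q, Real.exp (genInverse (cdf μ) y) := by
  refine intervalIntegral.intervalIntegral_pos_of_pos ?_ (fun y => Real.exp_pos _) hq.1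
  exact (intervalIntegrable_iff_integrableOn_Ioc_of_le hq.1.le).2 (integrableOn_exp_genInverse μ hq)

variable [IsProbabilityMeasure μ]

/-- The quantile transform: the generalized inverse of the distribution function maps the uniform
distribution to the given one. -/
theorem map_genInverse_cdf :
    (volume.restrict (Set.Ioo (0 : ℝ) 1)).map (genInverse (cdf μ)) = μ := by
  have : IsFiniteMeasure ((volume.restrict (Set.Ioo (0 : ℝ) 1)).map (genInverse (cdf μ))) :=
    inferInstance
  refine Measure.ext_of_Iic _ _ fun x => ?_
  have hset : genInverse (cdf μ) ⁻¹' Set.Iic x ∩ Set.Ioo 0 1 = Set.Iic (cdf μ x) ∩ Set.Ioo 0 1 := by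
    ext y
    simp only [Set.mem_inter_iff, Set.mem_preimage, Set.mem_Iic]
    exact and_congr_left fun hy => genInverse_cdf_le_iff μ hy x
  rw [Measure.map_apply_of_aemeasurable (aemeasurable_genInverse_cdf μ) measurableSet_Iic,
    Measure.restrict_apply₀' measurableSet_Ioo.nullMeasurableSet, hset, ← ofReal_cdf]
  apply le_antisymm
  · calc volume (Set.Iic (cdf μ x) ∩ Set.Ioo 0 1) ≤ volume (Set.Ioc 0 (cdf μ x)) :=
        measure_mono (show Set.Iic (cdf μ x) ∩ Set.Ioo 0 1 ⊆ Set.Ioc 0 (cdf μ x) from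
          fun y hy => ⟨hy.2.1, hy.1⟩)
      _ = _ := by rw [Real.volume_Ioc, sub_zero]
  · calc ENNReal.ofReal (cdf μ x) = volume (Set.Ioo 0 (cdf μ x)) := by
          rw [Real.volume_Ioo, sub_zero]
      _ ≤ volume (Set.Iic (cdf μ x) ∩ Set.Ioo 0 1) :=
        measure_mono (show Set.Ioo 0 (cdf μ x) ⊆ Set.Iic (cdf μ x) ∩ Set.Ioo 0 1 from
          fun y hy => ⟨hy.2.le, hy.1, hy.2.trans_le (cdf_le_one μ x)⟩)

theorem integral_eq_integral_genInverse {f : ℝ → ℝ} (hf : Measurable f) :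
    ∫ x, f x ∂μ = ∫ y in Set.Ioo (0 : ℝ) 1, f (genInverse (cdf μ) y) := by
  conv_lhs => rw [← map_genInverse_cdf μ]
  rw [integral_map (aemeasurable_genInverse_cdf μ) hf.aestronglyMeasurable]

/-- The integral of `exp F⁻¹` as a Legendre transform, at the maximizing point. -/
theorem integral_exp_genInverse_eq {q : ℝ} (hq : q ∈ Set.Ioo (0 : ℝ) 1) :
    ∫ y in (0 : ℝ)..q, Real.exp (genInverse (cdf μ) y) =
      Real.exp (genInverse (cdf μ) q) *
        (q - ∫ x, max (1 - Real.exp (x - genInverse (cdf μ) q)) 0 ∂μ) := by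
  set x₀ := genInverse (cdf μ) q with hx₀
  have hmono := monotoneOn_genInverse_cdf μ
  have hsub : Set.Ioc 0 q ⊆ Set.Ioo (0 : ℝ) 1 := fun y hy => ⟨hy.1, hy.2.trans_lt hq.2⟩
  have hI := integrableOn_exp_genInverse μ hq
  -- In the quantile variable y the positive part vanishes for y ≥ q and is inactive for y ≤ q, by
  -- monotonicity of F⁻¹.
  have h1 : ∫ x, max (1 - Real.exp (x - x₀)) 0 ∂μ =
      ∫ y in Set.Ioc 0 q, (1 - Real.exp (-x₀) * Real.exp (genInverse (cdf μ) y)) := by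
    rw [integral_eq_integral_genInverse μ (by fun_prop)]
    refine (setIntegral_eq_of_subset_of_forall_sdiff_eq_zero measurableSet_Ioo hsub ?_).trans ?_
    rotate_left
    · refine setIntegral_congr_fun measurableSet_Ioc fun y hy => ?_
      have := hmono (hsub hy) hq hy.2
      rw [← Real.exp_add, max_eq_left]
      · congr 2; ring
      · rw [sub_nonneg, Real.exp_le_one_iff]; linarith
    · intro y hy
      have hy' : q ≤ y := by
        by_contra h
        exact hy.2 ⟨hy.1.1, (not_le.1 h).le⟩
      have := hmono hq hy.1 hy'
      rw [max_eq_right]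
      rw [sub_nonpos, Real.one_le_exp_iff]
      linarith
  rw [h1, intervalIntegral.integral_of_le hq.1.le, integral_sub (integrable_const _)
    (hI.const_mul _), integral_const_mul, setIntegral_const]
  simp only [measureReal_def, Real.volume_Ioc, sub_zero, smul_eq_mul, mul_one]
  rw [ENNReal.toReal_ofReal hq.1.le, sub_sub_cancel, ← mul_assoc, ← Real.exp_add]
  simp

/-- A `[0,1]`-valued cut-off of prescribed mass below a quantile. -/
theorem exists_quantile_cut {q : ℝ} (hq : q ∈ Set.Ioo (0 : ℝ) 1) :
    ∃ θ ∈ Set.Icc (0 : ℝ) 1, ∀ b : ℝ → ℝ,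
      (b = fun x => if x < genInverse (cdf μ) q then 1
        else if x = genInverse (cdf μ) q then θ else 0) →
      ∫ x, b x ∂μ = q ∧ ∫ x, b x * Real.exp (min x (genInverse (cdf μ) q + 1)) ∂μ =
        ∫ y in (0 : ℝ)..q, Real.exp (genInverse (cdf μ) y) := by
  set x₀ := genInverse (cdf μ) q with hx₀
  have hmono := monotoneOn_genInverse_cdf μ
  have hsub : Set.Ioc 0 q ⊆ Set.Ioo (0 : ℝ) 1 := fun y hy => ⟨hy.1, hy.2.trans_lt hq.2⟩
  have hle : μ.real (Set.Iio x₀) ≤ q := by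
    have h1 : ∫ x, (Set.Iio x₀).indicator (1 : ℝ → ℝ) x ∂μ = μ.real (Set.Iio x₀) :=
      integral_indicator_one measurableSet_Iio
    rw [← h1, integral_eq_integral_genInverse μ (measurable_one.indicator measurableSet_Iio)]
    calc ∫ y in Set.Ioo (0 : ℝ) 1, (Set.Iio x₀).indicator (1 : ℝ → ℝ) (genInverse (cdf μ) y)
        ≤ ∫ y in Set.Ioo (0 : ℝ) 1, (Set.Ioc 0 q).indicator (1 : ℝ → ℝ) y := by
          refine integral_mono_of_nonneg (.of_forall fun y => Set.indicator_nonneg (by simp) _)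
            ((integrable_const (1 : ℝ)).indicator measurableSet_Ioc) ?_
          filter_upwards [ae_restrict_mem measurableSet_Ioo] with y hy
          by_cases h : genInverse (cdf μ) y < x₀
          · have hyq : y ≤ q := by
              by_contra hlt
              exact absurd (hmono hq hy (not_le.1 hlt).le) (not_le.2 h)
            rw [Set.indicator_of_mem (show y ∈ Set.Ioc 0 q from ⟨hy.1, hyq⟩)]
            exact Set.indicator_le_self' (by simp) _
          · rw [Set.indicator_of_notMem (by simpa using h)]
            exact Set.indicator_nonneg (by simp) _
      _ = q := by
          rw [setIntegral_indicator measurableSet_Ioc, Set.inter_eq_right.2 hsub]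
          simp [hq.1.le]
  have hge : q ≤ μ.real (Set.Iio x₀) + μ.real {x₀} := by
    have h1 : q ≤ cdf μ x₀ := (genInverse_cdf_le_iff μ hq x₀).1 le_rfl
    rw [cdf_eq_real, ← Set.Iio_union_right] at h1
    exact h1.trans (measureReal_union_le _ _)
  -- If x₀ is an atom, level q may fall inside its jump, and θ is the fraction of the atom that
  -- completes the mass to q.
  obtain ⟨θ, hθ, hθq⟩ : ∃ θ ∈ Set.Icc (0 : ℝ) 1, μ.real (Set.Iio x₀) + θ * μ.real {x₀} = q := by
    rcases (measureReal_nonneg (μ := μ) (s := {x₀})).eq_or_lt with h0 | h0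
    · refine ⟨0, by simp, ?_⟩
      rw [← h0] at hge
      linarith
    · refine ⟨(q - μ.real (Set.Iio x₀)) / μ.real {x₀}, ⟨div_nonneg (by linarith) h0.le, ?_⟩, ?_⟩
      · rw [div_le_one h0]; linarith
      · field_simp; ring
  refine ⟨θ, hθ, ?_⟩
  rintro b hb
  have hbeq : b = fun x => (Set.Iio x₀).indicator (1 : ℝ → ℝ) x +
      θ * ({x₀} : Set ℝ).indicator (1 : ℝ → ℝ) x := by
    rw [hb]
    funext x
    rcases lt_trichotomy x x₀ with h | h | h
    · simp [h, h.ne]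
    · simp [h]
    · simp [h.not_gt, h.ne']
  have hbm : Measurable b := by
    rw [hbeq]
    exact (measurable_one.indicator measurableSet_Iio).add
      ((measurable_one.indicator (measurableSet_singleton _)).const_mul _)
  have hb01 : ∀ x, b x ∈ Set.Icc (0 : ℝ) 1 := by
    intro x
    rw [hb]
    dsimp only
    split_ifs <;> simp [hθ.1, hθ.2]
  have hmass : ∫ x, b x ∂μ = q := by
    have h1 : Integrable ((Set.Iio x₀).indicator (1 : ℝ → ℝ)) μ :=
      (integrable_const (1 : ℝ)).indicator measurableSet_Iio
    have h2 : Integrable (({x₀} : Set ℝ).indicator (1 : ℝ → ℝ)) μ :=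
      (integrable_const (1 : ℝ)).indicator (measurableSet_singleton _)
    rw [hbeq, integral_add h1 (h2.const_mul _), integral_const_mul, integral_indicator_one measurableSet_Iio,
      integral_indicator_one (measurableSet_singleton _), hθq]
  refine ⟨hmass, ?_⟩
  have hmass' := hmass
  rw [integral_eq_integral_genInverse μ hbm] at hmass'
  rw [integral_eq_integral_genInverse μ (by fun_prop), intervalIntegral.integral_of_le hq.1.le]
  have hbint : IntegrableOn (fun y => b (genInverse (cdf μ) y)) (Set.Ioo 0 1) := by
    refine Integrable.of_bound
      (hbm.comp_aemeasurable (aemeasurable_genInverse_cdf μ)).aestronglyMeasurable 1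
      (.of_forall fun y => ?_)
    rw [Real.norm_eq_abs, abs_of_nonneg (hb01 _).1]
    exact (hb01 _).2
  -- The cut-off and the indicator of (0, q] differ only where F⁻¹ = x₀, and both have mass q, so
  -- measuring the exponential relative to exp x₀ removes the difference. The truncation at x₀ + 1
  -- is inert where b ≠ 0.
  have hpoint : ∀ y ∈ Set.Ioo (0 : ℝ) 1,
      b (genInverse (cdf μ) y) * Real.exp (min (genInverse (cdf μ) y) (x₀ + 1)) =
        Real.exp x₀ * b (genInverse (cdf μ) y) + (Set.Ioc 0 q).indicator
          (fun y => Real.exp (genInverse (cdf μ) y) - Real.exp x₀) y := by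
    intro y hy
    rw [hb]
    dsimp only
    rcases lt_trichotomy (genInverse (cdf μ) y) x₀ with h | h | h
    · have hyq : y ≤ q := by
        by_contra hlt
        exact absurd (hmono hq hy (not_le.1 hlt).le) (not_le.2 h)
      rw [if_pos h, Set.indicator_of_mem (show y ∈ Set.Ioc 0 q from ⟨hy.1, hyq⟩),
        min_eq_left (by linarith)]
      ring
    · rw [if_neg h.not_lt, if_pos h, min_eq_left (by linarith), h]
      have : (Set.Ioc 0 q).indicator
          (fun y => Real.exp (genInverse (cdf μ) y) - Real.exp x₀) y = 0 := by
        rw [Set.indicator_apply_eq_zero]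
        intro _
        rw [h, sub_self]
      rw [this]
      ring
    · have hyq : y ∉ Set.Ioc 0 q := fun hy' => absurd (hmono hy hq hy'.2) (not_le.2 h)
      rw [if_neg h.not_gt, if_neg h.ne', Set.indicator_of_notMem hyq]
      ring
  have hI := integrableOn_exp_genInverse μ hq
  have hI2 : IntegrableOn (fun y => Real.exp (genInverse (cdf μ) y) - Real.exp x₀)
      (Set.Ioc 0 q) := hI.sub (integrableOn_const (by simp))
  rw [setIntegral_congr_fun measurableSet_Ioo hpoint, integral_add (hbint.const_mul _)
    (((integrable_indicator_iff measurableSet_Ioc).2 hI2).integrableOn), integral_const_mul, hmass',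
    setIntegral_indicator measurableSet_Ioc, Set.inter_eq_right.2 hsub,
    integral_sub hI (integrableOn_const (by simp)), setIntegral_const]
  simp only [measureReal_def, Real.volume_Ioc, sub_zero, smul_eq_mul]
  rw [ENNReal.toReal_ofReal hq.1.le]
  ring

end Quantile

/-! ### Counting the largest weights: continuous cut-offs, rounding, duality. -/

/-- A continuous cut-off whose mass exceeds `q`, while its exponential moment is nearly that of the
part of the distribution below the `q`-quantile. -/
theorem exists_continuous_cutoff (μ : Measure ℝ) [IsProbabilityMeasure μ] {q C : ℝ}
    (hq : q ∈ Set.Ioo (0 : ℝ) 1)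
    (hC : ∫ y in (0 : ℝ)..q, Real.exp (genInverse (cdf μ) y) < C) :
    ∃ (h : ℝ → ℝ) (B : ℝ), Continuous h ∧ (∀ x, h x ∈ Set.Icc (0 : ℝ) 1) ∧
      (∀ x, B ≤ x → h x = 0) ∧ q < ∫ x, h x ∂μ ∧ ∫ x, h x * Real.exp x ∂μ < C := by
  -- r only provides room for the continuity of the primitive at q; then q is raised to q' > q,
  -- still below C, so that the mass inequality can be strict.
  obtain ⟨r, hqr, hr1⟩ := exists_between hq.2
  have hr : r ∈ Set.Ioo (0 : ℝ) 1 := ⟨hq.1.trans hqr, hr1⟩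
  have hcont : ContinuousOn (fun x => ∫ y in (0 : ℝ)..x, Real.exp (genInverse (cdf μ) y))
      (Set.uIcc 0 r) := by
    refine intervalIntegral.continuousOn_primitive_interval ?_
    rw [Set.uIcc_of_le hr.1.le, integrableOn_Icc_iff_integrableOn_Ioc]
    exact integrableOn_exp_genInverse μ hr
  have hat : ContinuousAt (fun x => ∫ y in (0 : ℝ)..x, Real.exp (genInverse (cdf μ) y)) q := by
    refine hcont.continuousAt ?_
    rw [Set.uIcc_of_le hr.1.le]
    exact Icc_mem_nhds hq.1 hqr
  have hev : ∀ᶠ x in 𝓝[>] q, ∫ y in (0 : ℝ)..x, Real.exp (genInverse (cdf μ) y) < C :=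
    (hat.eventually (gt_mem_nhds hC)).filter_mono nhdsWithin_le_nhds
  obtain ⟨q', hq'C, hqq', hq'1⟩ := (hev.and (Ioo_mem_nhdsGT hq.2)).exists
  have hq' : q' ∈ Set.Ioo (0 : ℝ) 1 := ⟨hq.1.trans hqq', hq'1⟩
  obtain ⟨θ, hθ, hb⟩ := exists_quantile_cut μ hq'
  obtain ⟨hb1, hb2⟩ := hb _ rfl
  set x₀ := genInverse (cdf μ) q' with hx₀
  set b : ℝ → ℝ := fun x => if x < x₀ then 1 else if x = x₀ then θ else 0 with hbdef
  -- The first ramp tends to the indicator of x < x₀, the second to that of x ≤ x₀; the weights 1 −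
  -- θ and θ produce the value θ at x₀.
  let g : ℕ → ℝ → ℝ := fun k x =>
    (1 - θ) * max 0 (min 1 ((k + 1) * (x₀ - x))) + θ * max 0 (min 1 (1 + (k + 1) * (x₀ - x)))
  have hclamp : ∀ y : ℝ, 0 ≤ max 0 (min 1 y) ∧ max 0 (min 1 y) ≤ 1 := fun y =>
    ⟨le_max_left _ _, max_le zero_le_one (min_le_left _ _)⟩
  have hgcont : ∀ k, Continuous (g k) := fun k => by fun_prop
  have hg01 : ∀ k x, g k x ∈ Set.Icc (0 : ℝ) 1 := by
    intro k x
    have h1 := hclamp ((k + 1) * (x₀ - x))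
    have h2 := hclamp (1 + (k + 1) * (x₀ - x))
    have h3 := hθ.1
    have h4 : 0 ≤ 1 - θ := by linarith [hθ.2]
    refine ⟨add_nonneg (mul_nonneg h4 h1.1) (mul_nonneg h3 h2.1), ?_⟩
    calc g k x ≤ (1 - θ) * 1 + θ * 1 :=
          add_le_add (mul_le_mul_of_nonneg_left h1.2 h4) (mul_le_mul_of_nonneg_left h2.2 h3)
      _ = 1 := by ring
  have hgzero : ∀ k x, x₀ + 1 ≤ x → g k x = 0 := by
    intro k x hx
    have hk : (0 : ℝ) ≤ k := k.cast_nonneg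
    have h1 : ((k : ℝ) + 1) * (x₀ - x) ≤ -1 := by nlinarith
    simp only [g]
    rw [max_eq_left ((min_le_right _ _).trans (by linarith)),
      max_eq_left ((min_le_right _ _).trans (by linarith))]
    ring
  have hglim : ∀ x, Tendsto (fun k => g k x) atTop (𝓝 (b x)) := by
    intro x
    refine tendsto_const_nhds.congr' ?_
    rcases lt_trichotomy x x₀ with h | h | h
    · obtain ⟨N, hN⟩ := exists_nat_gt (1 / (x₀ - x))
      filter_upwards [eventually_ge_atTop N] with k hk
      have hpos : 0 < x₀ - x := sub_pos.2 h
      have h1 : 1 ≤ ((k : ℝ) + 1) * (x₀ - x) := by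
        rw [div_lt_iff₀ hpos] at hN
        have : (N : ℝ) ≤ k := by exact_mod_cast hk
        nlinarith
      simp only [g, hbdef, if_pos h]
      rw [min_eq_left h1, min_eq_left (by linarith)]
      norm_num
    · filter_upwards with k
      simp [g, hbdef, h]
    · obtain ⟨N, hN⟩ := exists_nat_gt (1 / (x - x₀))
      filter_upwards [eventually_ge_atTop N] with k hk
      have hpos : 0 < x - x₀ := sub_pos.2 h
      have h1 : ((k : ℝ) + 1) * (x₀ - x) ≤ -1 := by
        rw [div_lt_iff₀ hpos] at hN
        have : (N : ℝ) ≤ k := by exact_mod_cast hk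
        nlinarith
      simp only [g, hbdef, if_neg h.not_gt, if_neg h.ne']
      rw [max_eq_left ((min_le_right _ _).trans (by linarith)),
        max_eq_left ((min_le_right _ _).trans (by linarith))]
      ring
  have hnorm : ∀ k x, ‖g k x‖ ≤ 1 := fun k x => by
    rw [Real.norm_eq_abs, abs_of_nonneg (hg01 k x).1]
    exact (hg01 k x).2
  have hlim1 : Tendsto (fun k => ∫ x, g k x ∂μ) atTop (𝓝 q') := by
    rw [← hb1]
    exact tendsto_integral_of_dominated_convergence (fun _ => 1)
      (fun k => (hgcont k).aestronglyMeasurable) (integrable_const _)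
      (fun k => .of_forall (hnorm k)) (.of_forall hglim)
  have hlim2 : Tendsto (fun k => ∫ x, g k x * Real.exp (min x (x₀ + 1)) ∂μ) atTop
      (𝓝 (∫ y in (0 : ℝ)..q', Real.exp (genInverse (cdf μ) y))) := by
    rw [← hb2]
    refine tendsto_integral_of_dominated_convergence (fun _ => Real.exp (x₀ + 1))
      (fun k => ((hgcont k).mul (by fun_prop)).aestronglyMeasurable) (integrable_const _)
      (fun k => .of_forall fun x => ?_) (.of_forall fun x => (hglim x).mul_const _)
    rw [norm_mul, Real.norm_eq_abs (Real.exp _), Real.abs_exp, ← one_mul (Real.exp (x₀ + 1))]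
    exact mul_le_mul (hnorm k x) (Real.exp_le_exp.2 (min_le_right _ _)) (Real.exp_pos _).le
      zero_le_one
  obtain ⟨k, hk1, hk2⟩ := ((hlim1.eventually (lt_mem_nhds hqq')).and
    (hlim2.eventually (gt_mem_nhds hq'C))).exists
  refine ⟨g k, x₀ + 1, hgcont k, hg01 k, hgzero k, hk1, ?_⟩
  have heq : ∀ x, g k x * Real.exp x = g k x * Real.exp (min x (x₀ + 1)) := by
    intro x
    rcases le_total x (x₀ + 1) with h | h
    · rw [min_eq_left h]
    · rw [hgzero k x h, zero_mul, zero_mul]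
  simpa only [heq] using hk2

/-- Among finitely many indices with nonnegative weights, the largest `⌈∑ c⌉` weights carry at
least the mass of any `[0,1]`-valued selection `c`. -/
theorem exists_finset_card_le_sum_mul_le {ι : Type*} [DecidableEq ι] (B : Finset ι) {ν c : ι → ℝ}
    (hν : ∀ i ∈ B, 0 ≤ ν i) (hc : ∀ i ∈ B, c i ∈ Set.Icc (0 : ℝ) 1) :
    ∃ F ⊆ B, (F.card : ℝ) ≤ ∑ i ∈ B, c i + 1 ∧ ∑ i ∈ B, ν i * c i ≤ ∑ i ∈ F, ν i := by
  have hc0 : 0 ≤ ∑ i ∈ B, c i := Finset.sum_nonneg fun i hi => (hc i hi).1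
  set n := ⌈∑ i ∈ B, c i⌉₊ with hn
  have hn1 : (n : ℝ) ≤ ∑ i ∈ B, c i + 1 := (Nat.ceil_lt_add_one hc0).le
  have hn2 : ∑ i ∈ B, c i ≤ n := Nat.le_ceil _
  rcases le_total B.card n with hle | hle
  · refine ⟨B, subset_rfl, le_trans (by exact_mod_cast hle) hn1, Finset.sum_le_sum fun i hi => ?_⟩
    exact mul_le_of_le_one_right (hν i hi) (hc i hi).2
  obtain ⟨F, hF, hmax⟩ := Finset.exists_max_image (B.powersetCard n) (fun F => ∑ i ∈ F, ν i)
    (Finset.powersetCard_nonempty.2 hle)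
  rw [Finset.mem_powersetCard] at hF
  refine ⟨F, hF.1, by rw [hF.2]; exact hn1, ?_⟩
  have hswap : ∀ i ∈ F, ∀ j ∈ B \ F, ν j ≤ ν i := by
    intro i hi j hj
    rw [Finset.mem_sdiff] at hj
    have hj' : j ∉ F.erase i := fun h => hj.2 (Finset.mem_of_mem_erase h)
    have := hmax (insert j (F.erase i)) (by
      rw [Finset.mem_powersetCard, Finset.card_insert_of_notMem hj', Finset.card_erase_of_mem hi,
        hF.2]
      refine ⟨Finset.insert_subset hj.1 ((Finset.erase_subset _ _).trans hF.1), ?_⟩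
      have := Finset.card_pos.2 ⟨i, hi⟩
      omega)
    rw [Finset.sum_insert hj', ← Finset.add_sum_erase F ν hi] at this
    linarith
  -- A threshold separating chosen from rejected weights: the least chosen one, or, if nothing is
  -- chosen, the total as a crude upper bound. Exchanging c-mass outside F for the unused part 1 − c
  -- inside F then cannot lose weight.
  obtain ⟨τ, hτ0, hτF, hτB⟩ : ∃ τ : ℝ, 0 ≤ τ ∧ (∀ i ∈ F, τ ≤ ν i) ∧ ∀ j ∈ B \ F, ν j ≤ τ := by
    rcases F.eq_empty_or_nonempty with rfl | hne
    · refine ⟨∑ i ∈ B, ν i, Finset.sum_nonneg hν, by simp, fun j hj => ?_⟩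
      exact Finset.single_le_sum hν (Finset.mem_sdiff.1 hj).1
    · obtain ⟨i, hi, hmin⟩ := F.exists_min_image ν hne
      exact ⟨ν i, hν i (hF.1 hi), hmin, hswap i hi⟩
  have h1 : ∑ i ∈ B \ F, ν i * c i ≤ τ * ∑ i ∈ B \ F, c i := by
    rw [Finset.mul_sum]
    exact Finset.sum_le_sum fun i hi =>
      mul_le_mul_of_nonneg_right (hτB i hi) (hc i (Finset.mem_sdiff.1 hi).1).1
  have h2 : τ * ∑ i ∈ F, (1 - c i) ≤ ∑ i ∈ F, ν i * (1 - c i) := by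
    rw [Finset.mul_sum]
    exact Finset.sum_le_sum fun i hi =>
      mul_le_mul_of_nonneg_right (hτF i hi) (by linarith [(hc i (hF.1 hi)).2])
  have h3 : ∑ i ∈ B \ F, c i ≤ ∑ i ∈ F, (1 - c i) := by
    rw [Finset.sum_sub_distrib, Finset.sum_const, hF.2, nsmul_eq_mul, mul_one]
    linarith [Finset.sum_sdiff (f := c) hF.1]
  have h4 := mul_le_mul_of_nonneg_left h3 hτ0
  have h5 : ∑ i ∈ F, ν i * (1 - c i) = ∑ i ∈ F, ν i - ∑ i ∈ F, ν i * c i := by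
    rw [← Finset.sum_sub_distrib]
    exact Finset.sum_congr rfl fun i _ => by ring
  linarith [Finset.sum_sdiff (f := fun i => ν i * c i) hF.1]

theorem exists_finset_superlevel {p : ℕ → ℕ → ℝ} (hps : ∀ j, Summable (p j))
    (d : ℕ) {τ : ℝ} (hτ : 0 < τ) :
    ∃ B : Finset (Fin d × ℕ), (∀ x ∈ B, τ < p x.1 x.2) ∧
      ∀ G : ℕ → ℕ → ℝ, (∀ j k, p j k ≤ τ → G j k = 0) →
        ∑ x ∈ B, G x.1 x.2 = ∑ j ∈ Finset.range d, ∑' k, G j k := by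
  have hfin : {x : Fin d × ℕ | τ < p x.1 x.2}.Finite := by
    have h1 : ∀ j : Fin d, {k | τ < p j k}.Finite := fun j =>
      (finite_superlevel_of_summable (hps j) τ hτ).subset
        fun k (hk : τ < p j k) => hk.le
    refine (Set.finite_iUnion fun j => (h1 j).image (Prod.mk j)).subset ?_
    rintro ⟨j, k⟩ hjk
    exact Set.mem_iUnion.2 ⟨j, k, hjk, rfl⟩
  refine ⟨hfin.toFinset, fun x hx => by simpa using hx, fun G hG => ?_⟩
  have hzero : ∀ x ∉ hfin.toFinset, G (x : Fin d × ℕ).1 x.2 = 0 := fun x hx =>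
    hG _ _ (by simpa using hx)
  have h := tsum_eq_sum (L := .unconditional _) (f := fun x : Fin d × ℕ => G x.1 x.2) hzero
  rw [← h, (summable_of_ne_finset_zero hzero).tsum_prod, tsum_fintype,
    Finset.sum_range fun j => ∑' k, G j k]

/-- Translates the dual test function at −ln p − a into the excess over the threshold τ = exp(−a −
x). For p = 0 the value of the logarithm is irrelevant, as both sides vanish. -/
theorem mul_max_one_sub_exp {p a x : ℝ} (hp : 0 ≤ p) :
    p * max (1 - Real.exp (-Real.log p - a - x)) 0 = max (p - Real.exp (-a - x)) 0 := by
  rcases hp.eq_or_lt with rfl | hp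
  · rw [zero_mul, zero_sub, max_eq_right (neg_nonpos.2 (Real.exp_pos _).le)]
  · have hne : p ≠ 0 := hp.ne'
    rw [mul_max_of_nonneg _ _ hp.le, mul_zero, mul_sub, mul_one,
      show -Real.log p - a - x = -Real.log p + (-a - x) by ring, Real.exp_add, Real.exp_neg,
      Real.exp_log hp, mul_inv_cancel_left₀ hne]

/-- The asymptotics of a counting function squeezed between the number of the largest weights
needed for a given share of the total weight, and the corresponding dual bound. -/
theorem tendsto_count_div {p : ℕ → ℕ → ℝ} (hp : ∀ j k, 0 ≤ p j k) (hps : ∀ j, Summable (p j))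
    (hanti : ∀ j, Antitone (p j))
    (hS : Tendsto (fun d => ∑ j ∈ Finset.range d, ∑' k, p j k) atTop atTop)
    (hneg : (fun d : ℕ => ⨆ j : Fin d, p j 0) =o[atTop]
      fun d : ℕ => ∑ j ∈ Finset.range d, ∑' k, p j k)
    (a : ℕ → ℝ) (μ : Measure ℝ) [IsProbabilityMeasure μ]
    (hlim : ∀ f : BoundedContinuousFunction ℝ ℝ, Tendsto
      (fun d : ℕ => (∑ j ∈ Finset.range d, ∑' k, p j k * f (-Real.log (p j k) - a d)) /
        ∑ j ∈ Finset.range d, ∑' k, p j k) atTop (𝓝 (∫ y, f y ∂μ)))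
    (R : ℕ → ℝ) {q : ℝ} (hq : q ∈ Set.Ioo (0 : ℝ) 1)
    (hR : Tendsto (fun d => R d / ∑ j ∈ Finset.range d, ∑' k, p j k) atTop (𝓝 q))
    (N : ℕ → ℕ)
    (hupper : ∀ d (F : Finset (Fin d × ℕ)), (∀ x ∈ F, 0 < p x.1 x.2) →
      R d ≤ ∑ x ∈ F, p x.1 x.2 → N d ≤ F.card + 1)
    (hlower : ∀ d τ, 0 < τ →
      R d ≤ ∑ j ∈ Finset.range d, ∑' k, max (p j k - τ) 0 + τ * N d) :
    Tendsto (fun d => (N d : ℝ) /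
      (Real.exp (a d) * ∑ j ∈ Finset.range d, ∑' k, p j k)) atTop
      (𝓝 (∫ y in (0 : ℝ)..q, Real.exp (genInverse (cdf μ) y))) := by
  set S : ℕ → ℝ := fun d => ∑ j ∈ Finset.range d, ∑' k, p j k with hSdef
  refine tendsto_order.2 ⟨fun C hC => ?_, fun C hC => ?_⟩
  · set x₀ := genInverse (cdf μ) q with hx₀
    let f : BoundedContinuousFunction ℝ ℝ := BoundedContinuousFunction.ofNormedAddCommGroup
      (fun x => max (1 - Real.exp (x - x₀)) 0) (by fun_prop) 1 fun x => by
        rw [Real.norm_eq_abs, abs_of_nonneg (le_max_right _ _)]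
        exact max_le (by linarith [Real.exp_pos (x - x₀)]) zero_le_one
    have h1 := (hR.sub (hlim f)).const_mul (Real.exp x₀)
    rw [integral_exp_genInverse_eq μ hq] at hC
    filter_upwards [h1.eventually (lt_mem_nhds hC), hS.eventually_gt_atTop 0] with d hd hSd
    refine hd.trans_le ?_
    -- The threshold is the eigenvalue located at the q-quantile x₀ after centering by a_d.
    have h2 := hlower d (Real.exp (-a d - x₀)) (Real.exp_pos _)
    have h3 : ∀ j k, p j k * f (-Real.log (p j k) - a d) =
        max (p j k - Real.exp (-a d - x₀)) 0 := fun j k => mul_max_one_sub_exp (hp j k)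
    simp only [h3]
    rw [← sub_div, ← mul_div_assoc, div_le_div_iff₀ hSd (mul_pos (Real.exp_pos _) hSd)]
    have h4 : Real.exp x₀ * Real.exp (a d) * Real.exp (-a d - x₀) = 1 := by
      rw [← Real.exp_add, ← Real.exp_add, Real.exp_eq_one_iff]
      ring
    have h5 := mul_le_mul_of_nonneg_left (sub_le_iff_le_add'.2 h2)
      (mul_pos (mul_pos (Real.exp_pos x₀) (Real.exp_pos (a d))) hSd).le
    calc _ = Real.exp x₀ * Real.exp (a d) * S d * (R d - ∑ j ∈ Finset.range d,
          ∑' k, max (p j k - Real.exp (-a d - x₀)) 0) := by ring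
      _ ≤ _ := h5
      _ = Real.exp x₀ * Real.exp (a d) * Real.exp (-a d - x₀) * (N d * S d) := by ring
      _ = _ := by rw [h4, one_mul]
  · obtain ⟨C', hC', hC'C⟩ := exists_between hC
    obtain ⟨h, B, hcont, h01, hzero, hmass, hexp⟩ := exists_continuous_cutoff μ hq hC'
    let f₁ : BoundedContinuousFunction ℝ ℝ := BoundedContinuousFunction.ofNormedAddCommGroup
      h hcont 1 fun x => by
        rw [Real.norm_eq_abs, abs_of_nonneg (h01 x).1]
        exact (h01 x).2
    let f₂ : BoundedContinuousFunction ℝ ℝ := BoundedContinuousFunction.ofNormedAddCommGroup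
      (fun x => h x * Real.exp x) (by fun_prop) (Real.exp B) fun x => by
        rw [Real.norm_eq_abs, abs_of_nonneg (mul_nonneg (h01 x).1 (Real.exp_pos _).le)]
        rcases le_total B x with hB | hB
        · rw [hzero x hB, zero_mul]
          exact (Real.exp_pos _).le
        · exact (mul_le_of_le_one_left (Real.exp_pos _).le (h01 x).2).trans (Real.exp_le_exp.2 hB)
    have hsupp : ∀ d j k, p j k ≤ Real.exp (-a d - B) → p j k * h (-Real.log (p j k) - a d) = 0 := by
      intro d j k hjk
      rcases (hp j k).eq_or_lt with h0 | h0
      · rw [← h0, zero_mul]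
      · rw [hzero, mul_zero]
        have := (Real.log_le_iff_le_exp h0).2 hjk
        linarith
    -- The cut-off retains positive mass, so some eigenvalue exceeds exp(−a_d − B), and hence so
    -- does the largest one. As that is o(S_d), e^{a_d} S_d is unbounded; max M 1 keeps the divisor
    -- positive.
    have hE : Tendsto (fun d => Real.exp (a d) * S d) atTop atTop := by
      refine tendsto_atTop.2 fun M => ?_
      have hM : 0 < max M 1 := lt_max_of_lt_right one_pos
      filter_upwards [(hlim f₁).eventually (lt_mem_nhds (hq.1.trans hmass)),
        hneg.bound (div_pos (Real.exp_pos (-B)) hM), hS.eventually_gt_atTop 0] with d hd hd' hSd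
      obtain ⟨j, hj, k, hk⟩ : ∃ j < d, ∃ k, Real.exp (-a d - B) < p j k := by
        by_contra! hcon
        refine hd.ne' ?_
        rw [Finset.sum_eq_zero, zero_div]
        intro j hj
        refine (tsum_congr fun k => ?_).trans tsum_zero
        exact hsupp d j k (hcon j (Finset.mem_range.1 hj) k)
      have h1 : p j k ≤ ⨆ j : Fin d, p j 0 := (hanti j (Nat.zero_le k)).trans
        (le_ciSup (f := fun j : Fin d => p j 0) (Set.finite_range _).bddAbove ⟨j, hj⟩)
      have h2 := hk.le.trans (h1.trans ((Real.le_norm_self _).trans hd'))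
      rw [Real.norm_of_nonneg hSd.le, div_mul_eq_mul_div, le_div_iff₀ hM] at h2
      have h3 : Real.exp (a d + B) * Real.exp (-a d - B) = 1 := by
        rw [← Real.exp_add]; simp
      have h4 : Real.exp (a d + B) * Real.exp (-B) = Real.exp (a d) := by
        rw [← Real.exp_add]; simp
      calc M ≤ Real.exp (a d + B) * Real.exp (-a d - B) * max M 1 := by
            rw [h3, one_mul]; exact le_max_left _ _
        _ = Real.exp (a d + B) * (Real.exp (-a d - B) * max M 1) := by ring
        _ ≤ Real.exp (a d + B) * (Real.exp (-B) * S d) :=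
            mul_le_mul_of_nonneg_left h2 (Real.exp_pos _).le
        _ = _ := by rw [← mul_assoc, h4]
    -- One unit is lost in rounding the fractional selection, and one is the extra unit in `hupper`.
    have hrest := (tendsto_const_nhds (x := (2 : ℝ))).div_atTop hE
    have hgap := hR.eventually_lt (hlim f₁) hmass
    filter_upwards [hgap, (hlim f₂).eventually (gt_mem_nhds hexp),
      hrest.eventually (gt_mem_nhds (sub_pos.2 hC'C)), hS.eventually_gt_atTop 0] with d h1 h2 h3 hSd
    obtain ⟨T, hT, hTsum⟩ := exists_finset_superlevel hps d (Real.exp_pos (-a d - B))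
    have hpos : ∀ x ∈ T, 0 < p x.1 x.2 := fun x hx => (Real.exp_pos _).trans (hT x hx)
    obtain ⟨F, hF, hFcard, hFsum⟩ := exists_finset_card_le_sum_mul_le T
      (ν := fun x => p x.1 x.2) (c := fun x => h (-Real.log (p x.1 x.2) - a d))
      (fun x _ => hp _ _) fun x _ => h01 _
    rw [hTsum (fun j k => p j k * h (-Real.log (p j k) - a d)) (hsupp d)] at hFsum
    -- The unweighted count becomes a weighted average by inserting e^{a_d} p exp(−ln p − a_d) = 1,
    -- valid as p > 0 on T.
    have hcsum : ∑ x ∈ T, h (-Real.log (p x.1 x.2) - a d) = Real.exp (a d) *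
        ∑ j ∈ Finset.range d, ∑' k, p j k * f₂ (-Real.log (p j k) - a d) := by
      rw [← hTsum (fun j k => p j k * f₂ (-Real.log (p j k) - a d)) fun j k hjk => ?_,
        Finset.mul_sum]
      · refine Finset.sum_congr rfl fun x hx => ?_
        show _ = Real.exp (a d) * (p x.1 x.2 * (h (-Real.log (p x.1 x.2) - a d) *
          Real.exp (-Real.log (p x.1 x.2) - a d)))
        have h4 : Real.exp (a d) * p x.1 x.2 * Real.exp (-Real.log (p x.1 x.2) - a d) = 1 := by
          conv_lhs => rw [← Real.exp_log (hpos x hx), Real.log_exp]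
          rw [← Real.exp_add, ← Real.exp_add, Real.exp_eq_one_iff]
          ring
        linear_combination -h (-Real.log (p x.1 x.2) - a d) * h4
      · show p j k * (h _ * _) = 0
        rw [← mul_assoc, hsupp d j k hjk, zero_mul]
    have h5 : R d ≤ ∑ x ∈ F, p x.1 x.2 := by
      rw [div_lt_div_iff_of_pos_right hSd] at h1
      exact h1.le.trans hFsum
    have h6 : (N d : ℝ) ≤ F.card + 1 := by
      exact_mod_cast hupper d F (fun x hx => hpos x (hF hx)) h5
    rw [hcsum] at hFcard
    have hES : 0 < Real.exp (a d) * S d := mul_pos (Real.exp_pos _) hSd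
    rw [div_lt_iff₀ hSd] at h2
    rw [div_lt_iff₀ hES] at h3 ⊢
    have h7 := mul_lt_mul_of_pos_left h2 (Real.exp_pos (a d))
    calc (N d : ℝ) ≤ Real.exp (a d) *
          (∑ j ∈ Finset.range d, ∑' k, p j k * f₂ (-Real.log (p j k) - a d)) + 2 := by linarith
      _ < Real.exp (a d) * (C' * S d) + (C - C') * (Real.exp (a d) * S d) := add_lt_add h7 h3
      _ = _ := by ring

/-- The total weight is infinite if the largest weights are negligible. -/
theorem tendsto_sum_tsum_atTop {p : ℕ → ℕ → ℝ} (hp : ∀ j k, 0 ≤ p j k)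
    (hneg : (fun d : ℕ => ⨆ j : Fin d, p j 0) =o[atTop]
      fun d : ℕ => ∑ j ∈ Finset.range d, ∑' k, p j k)
    (hne : ∃ j, 0 < p j 0) :
    Tendsto (fun d => ∑ j ∈ Finset.range d, ∑' k, p j k) atTop atTop := by
  obtain ⟨j₀, hj₀⟩ := hne
  refine tendsto_atTop.2 fun M => ?_
  have hM : 0 < max M 1 := lt_max_of_lt_right one_pos
  -- A fixed positive eigenvalue is at most the maximum once d > j₀, so it is o(S_d); the constant
  -- is chosen to yield S_d ≥ max M 1.
  filter_upwards [hneg.bound (div_pos hj₀ hM), eventually_gt_atTop j₀] with d hd hjd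
  have h1 : p j₀ 0 ≤ ⨆ j : Fin d, p j 0 :=
    le_ciSup (f := fun j : Fin d => p j 0) (Set.finite_range _).bddAbove ⟨j₀, hjd⟩
  have h2 := h1.trans ((Real.le_norm_self _).trans hd)
  rw [Real.norm_of_nonneg (Finset.sum_nonneg fun j _ => tsum_nonneg (hp j)), div_mul_eq_mul_div,
    le_div_iff₀ hM, mul_le_mul_iff_right₀ hj₀] at h2
  exact (le_max_left _ _).trans h2

end

/-! ### Assembly of the asymptotics. -/

theorem mainTheorem2
    -- the marginal processes `X_j` (indexed from `0`) and their covariance functions `K j`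
    {Ω' : ℕ → Type*} [∀ j, MeasurableSpace (Ω' j)] (P' : ∀ j, Measure (Ω' j))
    [∀ j, IsProbabilityMeasure (P' j)] (X : ∀ j, Ω' j → I → ℝ)
    (hX : ∀ j, IsCenteredField (P' j) (X j))
    (K : ℕ → I → I → ℝ) (hK : ∀ j, K j = covFunc (P' j) (X j))
    (hKcont : ∀ j, Continuous (Function.uncurry (K j)))
    -- the additive random fields `Y_d` on `[0,1]^d`
    {Ω : ℕ → Type*} [∀ d, MeasurableSpace (Ω d)] (P : ∀ d, Measure (Ω d))
    [∀ d, IsProbabilityMeasure (P d)] (Y : ∀ d, Ω d → (Fin d → I) → ℝ)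
    (hY : ∀ d, IsCenteredField (P d) (Y d))
    (hYmeas : ∀ d, Measurable (Function.uncurry (Y d)))
    (hYcov : ∀ d t s, covFunc (P d) (Y d) t s = ∑ j : Fin d, K j (t j) (s j))
    -- the function `1` is an eigenvector of every marginal covariance operator
    (lam0 : ℕ → ℝ) (hlam0 : ∀ j, IsEigenfunction (K j) (lam0 j) oneL2)
    -- the share of the eigenvalue of `1` has a limit `1 - ε₀² < 1`
    (ε₀ : ℝ) (hε₀ : ε₀ ∈ Set.Ioc (0 : ℝ) 1)
    (hRegular : Tendsto
      (fun d : ℕ => (∑ j ∈ Finset.range d, lam0 j) / ∑ j ∈ Finset.range d, lamTrace (K j))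
      atTop (𝓝 (1 - ε₀ ^ 2)))
    -- the largest remaining eigenvalue is negligible
    (hNegl : (fun d : ℕ => ⨆ j : Fin d, tlamSeq (K j) 0) =o[atTop]
      fun d : ℕ => ∑ j ∈ Finset.range d, tlamTrace (K j))
    -- the shifted eigenvalue distributions converge to `U`
    (U : StieltjesFunction ℝ) (hU : IsDistributionFunction U) (ℓ : ℕ → ℝ)
    (hUconv : ∀ x, ContinuousAt U x → Tendsto
      (fun j : ℕ => 1 / tlamTrace (K j) *
        ∑' k, if -Real.log (tlamSeq (K j) k) - ℓ j ≤ x then tlamSeq (K j) k else 0)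
      atTop (𝓝 (U x)))
    -- monotonicity of the shifts and its sign
    (sgn : ℝ) (hsgn : (sgn = 1 ∧ Monotone ℓ) ∨ (sgn = -1 ∧ Antitone ℓ))
    -- the weight distributions of the centered shifts converge to `W`
    (W : StieltjesFunction ℝ) (hW : IsDistributionFunction W) (a : ℕ → ℝ)
    (hWconv : ∀ x, ContinuousAt W x → Tendsto
      (fun d : ℕ =>
        (∑ j ∈ Finset.range d, if sgn * (ℓ j - a d) ≤ x then tlamTrace (K j) else 0) /
          ∑ m ∈ Finset.range d, tlamTrace (K m))
      atTop (𝓝 (W x))) :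
    ∀ ε ∈ Set.Ioo 0 ε₀, Tendsto
      (fun d : ℕ => (approxComplexity (P d) (Y d) ε : ℝ) /
        (Real.exp (a d) * (∑ j ∈ Finset.range d, tlamTrace (K j)) *
          ∫ y in (0 : ℝ)..(1 - (ε / ε₀) ^ 2),
            Real.exp (genInverse (fun x => ∫ v, U (x - sgn * v) ∂W.measure) y)))
      atTop (𝓝 1) := by
  intro ε hε
  obtain ⟨hmarg, hcount⟩ := additive_eigenvalue_bounds P' X hX K hK hKcont P Y hY hYmeas hYcov
    lam0 hlam0
  have hp : ∀ j k, 0 ≤ tlamSeq (K j) k := fun j => (hmarg j).2.1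
  have hps : ∀ j, Summable (tlamSeq (K j)) := fun j => (hmarg j).2.2.2.1
  have hanti : ∀ j, Antitone (tlamSeq (K j)) := fun j => (hmarg j).2.2.1
  set S : ℕ → ℝ := fun d => ∑ j ∈ Finset.range d, tlamTrace (K j) with hSdef
  set c : ℕ → ℝ := fun d => ∑ j ∈ Finset.range d, lam0 j with hcdef
  have hΛ : ∀ d, ∑ j ∈ Finset.range d, lamTrace (K j) = c d + S d := fun d => by
    rw [hcdef, hSdef, ← Finset.sum_add_distrib]
    exact Finset.sum_congr rfl fun j _ => (hmarg j).2.2.2.2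
  have hc0 : ∀ d, 0 ≤ c d := fun d => Finset.sum_nonneg fun j _ => (hmarg j).1
  have hS : Tendsto S atTop atTop := by
    refine tendsto_sum_tsum_atTop hp hNegl ?_
    obtain ⟨j, hj⟩ := (eventually_tsum_pos hp U hU ℓ hUconv).exists
    refine ⟨j, (hp j 0).lt_of_ne fun h0 => hj.ne' ?_⟩
    have : ∀ k, tlamSeq (K j) k = 0 := fun k =>
      le_antisymm ((hanti j (Nat.zero_le k)).trans_eq h0.symm) (hp j k)
    simp [this]
  have hsq : sgn * sgn = 1 := by rcases hsgn with h | h <;> simp [h.1]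
  have hUp : IsProbabilityMeasure U.measure := U.isProbabilityMeasure hU.1 hU.2
  have hWp : IsProbabilityMeasure W.measure := W.isProbabilityMeasure hW.1 hW.2
  have hρp : IsProbabilityMeasure (W.measure.map (sgn * ·)) :=
    Measure.isProbabilityMeasure_map (by fun_prop)
  set μ := U.measure.conv (W.measure.map (sgn * ·)) with hμ
  have hF : (fun x => ∫ v, U (x - sgn * v) ∂W.measure) = cdf μ := by
    funext x
    rw [cdf_eq_real, hμ, measureReal_Iic_conv U W hU hW]
  have hq : 1 - (ε / ε₀) ^ 2 ∈ Set.Ioo (0 : ℝ) 1 := by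
    have h1 : ε / ε₀ < 1 := (div_lt_one hε₀.1).2 hε.2
    have h2 : 0 < ε / ε₀ := div_pos hε.1 hε₀.1
    constructor <;> nlinarith
  -- The remaining eigenvalues must supply (1 − ε²)(c + S) − c = S − ε²(c + S), and S/(c + S) tends
  -- to ε₀² by the first condition.
  have hR : Tendsto (fun d => (S d - ε ^ 2 * (c d + S d)) / S d) atTop
      (𝓝 (1 - (ε / ε₀) ^ 2)) := by
    have h1 : Tendsto (fun d => 1 - ε ^ 2 / (1 - c d / (c d + S d))) atTop
        (𝓝 (1 - ε ^ 2 / (1 - (1 - ε₀ ^ 2)))) := by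
      simp only [hΛ] at hRegular
      refine tendsto_const_nhds.sub (tendsto_const_nhds.div (tendsto_const_nhds.sub hRegular) ?_)
      have := pow_pos hε₀.1 2
      linarith
    rw [sub_sub_cancel, ← div_pow] at h1
    refine h1.congr' ?_
    filter_upwards [hS.eventually_gt_atTop 0] with d hd
    have h2 : c d + S d ≠ 0 := by linarith [hc0 d]
    have h3 : 1 - c d / (c d + S d) = S d / (c d + S d) := by
      field_simp
      ring
    rw [h3, sub_div, div_self hd.ne', div_div_eq_mul_div]
  have hmain := tendsto_count_div hp hps hanti hS hNegl a μ
    (tendsto_eigenvalue_average hp hps hS U hU ℓ hUconv sgn hsq W hW a hWconv)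
    (fun d => S d - ε ^ 2 * (c d + S d)) hq hR (fun d => approxComplexity (P d) (Y d) ε)
    (fun d F hFpos hle => (hcount d ε hε.1).1 F hFpos (by rw [hΛ]; linarith))
    (fun d τ hτ => by
      have := (hcount d ε hε.1).2 τ hτ
      rw [hΛ] at this
      linarith)
  rw [hF]
  have hI := integral_exp_genInverse_pos μ hq
  have := hmain.div_const (∫ y in (0 : ℝ)..(1 - (ε / ε₀) ^ 2), Real.exp (genInverse (cdf μ) y))
  rw [div_self hI.ne'] at this
  refine this.congr fun d => ?_
  rw [div_div]
  rfl
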